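/- **Setting.** Consider the model $y_k=\boldsymbol{x}_k^\top\boldsymbol{\theta}^\star+\epsilon_k$, $k=1,\dots,n$, where $\boldsymbol{\theta}^\star\in\mathbb{R}^d$ has at most $s\ge 1$ non-zero entries, $\boldsymbol{x}_1,\dots,\boldsymbol{x}_n$ are i.i.d. random vectors in $\mathbb{R}^d$, and $\epsilon_1,\dots,\epsilon_n$ are i.i.d. random variables independent of $(\boldsymbol{x}_k)_k$. For a random variable $X$ put $\|X\|_{\psi_2}=\inf\{t>0:\mathbb{E}\exp(X^2/t^2)\le 2\}$, and for a random vector put $\|\boldsymbol{x}\|_{\psi_2}=\sup_{\|\boldsymbol{v}\|_2=1}\|\boldsymbol{v}^\top\boldsymbol{x}\|_{\psi_2}$. Assume that $\mathbb{E}\boldsymbol{x}_k=0$, that $\|\boldsymbol{x}_k\|_{\psi_2}\le\sigma$ with $\sigma>0$, that $\kappa_0\le\lambda_{\min}(\boldsymbol{\Sigma}^\star)\le\lambda_{\max}(\boldsymbol{\Sigma}^\star)\le\kappa_1$ for some $\kappa_1>\kappa_0>0$, where $\boldsymbol{\Sigma}^\star=\mathbb{E}(\boldsymbol{x}_k\boldsymbol{x}_k^\top)$,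 and that $\mathbb{E}|y_k|^{2l}\le M$ for some fixed $l>1$ and some $M>0$. **Quantization.** Let $\Delta\ge 0$. Put $\mathcal{Q}_\Delta(a)=\Delta\big(\lfloor a/\Delta\rfloor+\tfrac12\big)$ for $\Delta>0$ and $\mathcal{Q}_0(a)=a$. Let $\tau_1,\dots,\tau_n$ be i.i.d., independent of $(\boldsymbol{x}_k,\epsilon_k)_k$ and uniformly distributed on $[-\tfrac{\Delta}{2},\tfrac{\Delta}{2}]$ (so $\tau_k=0$ a.s. if $\Delta=0$). With a threshold $\zeta_y$ put $\widetilde y_k=\operatorname{sign}(y_k)\min\{|y_k|,\zeta_y\}$ and $\dot y_k=\mathcal{Q}_\Delta(\widetilde y_k+\tau_k)$. **Estimator.** Let $\widehat{\boldsymbol{\theta}}$ be a minimizer over $\boldsymbol{\theta}\in\mathbb{R}^d$ of the generalized Lasso objective $\tfrac12\boldsymbol{\theta}^\top\boldsymbol{Q}\boldsymbol{\theta}-\boldsymbol{b}^\top\boldsymbol{\theta}+\lambda\|\boldsymbol{\theta}\|_1$ with $\boldsymbol{Q}=\frac1n\sum_{k=1}^n\boldsymbol{x}_k\boldsymbol{x}_k^\top$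 and $\boldsymbol{b}=\frac1n\sum_{k=1}^n\dot y_k\boldsymbol{x}_k$. **Theorem.** There is a function $N(\kappa_0,\sigma)>0$ of $(\kappa_0,\sigma)$ alone such that for every $l>1$ and all $c_1,c_2>0$ there is $C_0>0$ (depending only on $l,c_1,c_2$) such that for every $C_1\ge C_0$ there are $C_3,C_4>0$ (depending only on $l,c_1,c_2,C_1$) with the following property. Let $\delta>0$, and in the above setting let $$c_1\Big(\frac{nM^{1/l}}{\delta\log d}\Big)^{1/2}\le\zeta_y\le c_2\Big(\frac{nM^{1/l}}{\delta\log d}\Big)^{1/2},\qquad \lambda=C_1\frac{\sigma^2}{\sqrt{\kappa_0}}\big(\Delta+M^{1/(2l)}\big)\sqrt{\frac{\delta\log d}{n}},\qquad n\ge N(\kappa_0,\sigma)\,\delta s\log d .$$ Then with probability at least $1-9d^{1-\delta}$ a minimizer exists, and every minimizer $\widehat{\boldsymbol{\theta}}$ satisfies $$\|\widehat{\boldsymbol{\theta}}-\boldsymbol{\theta}^\star\|_2\le C_3\,\mathscr{L}\sqrt{\frac{\delta s\log d}{n}}\qquad\text{and}\qquad\|\widehat{\boldsymbol{\theta}}-\boldsymbol{\theta}^\star\|_1\le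 C_4\,\mathscr{L}\,s\sqrt{\frac{\delta\log d}{n}},\qquad \mathscr{L}=\frac{\sigma^2(\Delta+M^{1/(2l)})}{\kappa_0^{3/2}} .$$ -/

import Mathlib

open MeasureTheory ProbabilityTheory
open scoped ENNReal Matrix

namespace QuantizedCS

noncomputable section

/-- The `ℓ₁` norm of a vector of `ℝ^d`. -/
def l1Norm {d : ℕ} (v : Fin d → ℝ) : ℝ := ∑ i, |v i|

/-- The `ℓ₂` norm of a vector of `ℝ^d`. -/
def l2Norm {d : ℕ} (v : Fin d → ℝ) : ℝ := Real.sqrt (∑ i, v i ^ 2)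

/-- `θ` has at most `s` non-zero entries. -/
def IsSparse {d : ℕ} (s : ℕ) (θ : Fin d → ℝ) : Prop :=
  (Finset.univ.filter fun i => θ i ≠ 0).card ≤ s

/-- The sub-Gaussian norm `inf {t > 0 : E exp (X² / t²) ≤ 2}` of a real random variable; it is `∞`
when there is no such `t`. -/
def psi2Norm {Ω : Type*} [MeasurableSpace Ω] (μ : Measure Ω) (X : Ω → ℝ) : ℝ≥0∞ :=
  ⨅ (t : ℝ) (_ : 0 < t)
    (_ : ∫⁻ ω, ENNReal.ofReal (Real.exp (X ω ^ 2 / t ^ 2)) ∂μ ≤ 2), ENNReal.ofReal t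

/-- The sub-Gaussian norm of a random vector: the supremum of `‖vᵀX‖_ψ₂` over the unit sphere. -/
def psi2NormVec {Ω : Type*} [MeasurableSpace Ω] {d : ℕ} (μ : Measure Ω) (X : Ω → Fin d → ℝ) :
    ℝ≥0∞ :=
  ⨆ (v : Fin d → ℝ) (_ : l2Norm v = 1), psi2Norm μ fun ω => v ⬝ᵥ X ω

/-- The second moment matrix `E (X Xᵀ)` of a random vector. -/
def secondMoment {Ω : Type*} [MeasurableSpace Ω] {d : ℕ} (μ : Measure Ω) (X : Ω → Fin d → ℝ) :
    Matrix (Fin d) (Fin d) ℝ :=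
  Matrix.of fun i j => ∫ ω, X ω i * X ω j ∂μ

/-- The uniform quantizer with quantization level `Δ`, with the convention `Q₀(a) = a`. -/
def quantizer (Δ a : ℝ) : ℝ := if Δ = 0 then a else Δ * ((⌊a / Δ⌋ : ℝ) + 1 / 2)

/-- Truncation of `a` at the threshold `ζ`. -/
def truncate (ζ a : ℝ) : ℝ := Real.sign a * min |a| ζ

/-- The uniform distribution on `[-Δ/2, Δ/2]` (the point mass at `0` when `Δ = 0`). -/
def ditherLaw (Δ : ℝ) : Measure ℝ :=
  if Δ = 0 then Measure.dirac 0 else cond volume (Set.Icc (-(Δ / 2)) (Δ / 2))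

/-- The truncated, dithered and quantized response. -/
def quantizedResponse (Δ ζ y τ : ℝ) : ℝ := quantizer Δ (truncate ζ y + τ)

/-- The sample covariance `(1/n) ∑ x_k x_kᵀ`. -/
def sampleCov {n d : ℕ} (x : Fin n → Fin d → ℝ) : Matrix (Fin d) (Fin d) ℝ :=
  (1 / (n : ℝ)) • ∑ k, Matrix.vecMulVec (x k) (x k)

/-- The vector `(1/n) ∑ z_k x_k`. -/
def sampleCross {n d : ℕ} (z : Fin n → ℝ) (x : Fin n → Fin d → ℝ) : Fin d → ℝ :=
  (1 / (n : ℝ)) • ∑ k, z k • x k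

/-- The objective `½ θᵀQθ - bᵀθ + lam ‖θ‖₁` of the generalized Lasso. -/
def lassoObjective {d : ℕ} (Q : Matrix (Fin d) (Fin d) ℝ) (b : Fin d → ℝ) (lam : ℝ)
    (θ : Fin d → ℝ) : ℝ :=
  1 / 2 * (θ ⬝ᵥ (Q *ᵥ θ)) - b ⬝ᵥ θ + lam * l1Norm θ

/-- The set of solutions of the generalized Lasso over the constraint set `S`. -/
def generalizedLasso {d : ℕ} (S : Set (Fin d → ℝ)) (Q : Matrix (Fin d) (Fin d) ℝ)
    (b : Fin d → ℝ) (lam : ℝ) : Set (Fin d → ℝ) :=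
  {θ | θ ∈ S ∧ IsMinOn (lassoObjective Q b lam) S θ}

end

end QuantizedCS

open QuantizedCS

namespace QuantizedCS

/-! ### Elementary `ℓ₁` and `ℓ₂` estimates -/

section Norms

variable {d : ℕ}

/-! Put `r = √(δ log d / n)`, `m = M ^ (1/(2l))`, `K = 2σ`. The argument separates a deterministic
Lasso analysis from two probabilistic estimates.

Deterministic part: suppose every entry of `b - Qθ⋆` is at most `λ/2` in absolute value. Then a
minimizer exists, and comparing the objective at `θ⋆` and at `θ⋆ + h` puts the error `h` in the cone
`‖h‖₁ ≤ 4√s‖h‖₂`, with `hᵀQh ≤ 3λ√s‖h‖₂` (`generalizedLasso_basic`). If also `hᵀQh ≥ (κ₀/2)‖h‖₂²` on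
that cone, both error bounds follow (`generalizedLasso_error`).

Curvature (`restricted_eigenvalue`): a Bernstein bound for products of sub-Gaussian variables and a
union bound over nets of sparse vectors control the bilinear form of the covariance deviation on
pairs of sparse vectors. Peeling off blocks of largest coordinates extends this to the whole cone
(`bilinear_le_of_sparse_bound`).

Gradient (`abs_sampleCross_sub_le`): `b - Qθ⋆` splits into the fluctuation of the quantized response
times a covariate, the fluctuation of `Qθ⋆`, and a bias. Uniform dither makes quantization unbiased,
so only truncation contributes bias, of order `K m² / ζ`. Truncation also bounds the response by `ζ
+ Δ`, which allows an exponential moment at scale `1/(K(ζ + Δ))`, while the variance proxy stays of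
order `K²(m + Δ)²`. The choice `ζ ≍ m/r` balances the two effects, each being of order `r`. The
factor `‖θ⋆‖₂` in front of the second fluctuation is eliminated by `κ₀‖θ⋆‖₂² ≤ E y² ≤ m²`
(`signal_norm_sq_le`), which is where `1/√κ₀` in `λ` comes from.

The probability bound has content only for `d ≥ 2` and `δ ≥ 1`, apart from the trivial dimension
zero. -/

theorem l1Norm_nonneg (v : Fin d → ℝ) : 0 ≤ l1Norm v :=
  Finset.sum_nonneg fun _ _ => abs_nonneg _

theorem l2Norm_nonneg (v : Fin d → ℝ) : 0 ≤ l2Norm v := Real.sqrt_nonneg _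

theorem l2Norm_sq (v : Fin d → ℝ) : l2Norm v ^ 2 = ∑ i, v i ^ 2 :=
  Real.sq_sqrt (Finset.sum_nonneg fun _ _ => sq_nonneg _)

theorem l2Norm_eq_norm (v : Fin d → ℝ) : l2Norm v = ‖WithLp.toLp 2 v‖ := by
  rw [EuclideanSpace.norm_eq]
  simp [l2Norm]

theorem l2Norm_smul (c : ℝ) (v : Fin d → ℝ) : l2Norm (c • v) = |c| * l2Norm v := by
  rw [l2Norm_eq_norm, l2Norm_eq_norm, WithLp.toLp_smul, norm_smul, Real.norm_eq_abs]

theorem l2Norm_eq_zero {v : Fin d → ℝ} (h : l2Norm v = 0) : v = 0 := by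
  rw [l2Norm_eq_norm, norm_eq_zero] at h
  simpa using h

theorem l2Norm_single (i : Fin d) : l2Norm (Pi.single i (1 : ℝ)) = 1 := by
  have : l2Norm (Pi.single i (1 : ℝ)) ^ 2 = 1 := by
    rw [l2Norm_sq, Finset.sum_eq_single i] <;> simp +contextual
  nlinarith [l2Norm_nonneg (Pi.single i (1 : ℝ))]

theorem abs_dotProduct_le (v w : Fin d → ℝ) : |v ⬝ᵥ w| ≤ l2Norm v * l2Norm w := by
  refine Real.abs_le_sqrt ?_ |>.trans_eq
    (Real.sqrt_mul (Finset.sum_nonneg fun _ _ => sq_nonneg _) _)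
  exact Finset.sum_mul_sq_le_sq_mul_sq _ _ _

theorem abs_dotProduct_le_of_abs_le {e : Fin d → ℝ} {r : ℝ} (he : ∀ i, |e i| ≤ r)
    (v : Fin d → ℝ) : |e ⬝ᵥ v| ≤ r * l1Norm v := by
  rw [l1Norm, Finset.mul_sum]
  refine (Finset.abs_sum_le_sum_abs _ _).trans (Finset.sum_le_sum fun i _ => ?_)
  rw [abs_mul]
  exact mul_le_mul_of_nonneg_right (he i) (abs_nonneg _)

theorem sum_abs_le_sqrt_mul (T : Finset (Fin d)) {s : ℕ} (hT : T.card ≤ s) (v : Fin d → ℝ) :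
    ∑ i ∈ T, |v i| ≤ Real.sqrt s * l2Norm v := by
  rw [l2Norm, ← Real.sqrt_mul (Nat.cast_nonneg s)]
  refine Real.le_sqrt_of_sq_le ?_
  calc (∑ i ∈ T, |v i|) ^ 2 ≤ T.card * ∑ i ∈ T, |v i| ^ 2 := sq_sum_le_card_mul_sum_sq
    _ ≤ s * ∑ i, v i ^ 2 := by
      simp only [sq_abs]
      gcongr
      exact Finset.subset_univ T

end Norms

/-! ### Deterministic analysis of the generalized Lasso -/

section Lasso

variable {d : ℕ}

theorem lassoObjective_eq (Q : Matrix (Fin d) (Fin d) ℝ) (hQ : Q.IsSymm) (b θs h : Fin d → ℝ)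
    (lam : ℝ) :
    lassoObjective Q b lam (θs + h) = lassoObjective Q b lam θs + 1 / 2 * (h ⬝ᵥ (Q *ᵥ h))
      - (b - Q *ᵥ θs) ⬝ᵥ h + lam * (l1Norm (θs + h) - l1Norm θs) := by
  have : θs ⬝ᵥ (Q *ᵥ h) = (Q *ᵥ θs) ⬝ᵥ h := by
    rw [Matrix.dotProduct_mulVec, ← Matrix.mulVec_transpose, hQ.eq]
  have h2 : h ⬝ᵥ (Q *ᵥ θs) = (Q *ᵥ θs) ⬝ᵥ h := dotProduct_comm _ _
  simp only [lassoObjective, Matrix.mulVec_add, dotProduct_add, add_dotProduct, sub_dotProduct,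
    this, h2]
  ring

theorem continuous_lassoObjective (Q : Matrix (Fin d) (Fin d) ℝ) (b : Fin d → ℝ) (lam : ℝ) :
    Continuous (lassoObjective Q b lam) := by
  unfold lassoObjective l1Norm
  fun_prop

/-- Coercivity comes from the penalty, since `Q` may be singular: the linear term costs at most
`lam/2 * ‖h‖₁`, so half of the penalty survives and the objective grows like `lam/2 * ‖h‖₁` up to a
constant. -/
theorem generalizedLasso_nonempty (Q : Matrix (Fin d) (Fin d) ℝ) (hQ : Q.IsSymm)
    (hpos : ∀ h : Fin d → ℝ, 0 ≤ h ⬝ᵥ (Q *ᵥ h)) (b θs : Fin d → ℝ) {lam : ℝ} (hlam : 0 < lam)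
    (hb : ∀ i, |(b - Q *ᵥ θs) i| ≤ lam / 2) :
    (generalizedLasso Set.univ Q b lam).Nonempty := by
  set f := fun h => lassoObjective Q b lam (θs + h)
  have hf : Continuous f := (continuous_lassoObjective Q b lam).comp (continuous_const.add
    continuous_id)
  have hlow : ∀ h, f 0 - 2 * lam * l1Norm θs + lam / 2 * l1Norm h ≤ f h := by
    intro h
    have h1 := lassoObjective_eq Q hQ b θs h lam
    have h2 := abs_le.1 (abs_dotProduct_le_of_abs_le hb h)
    have h3 : l1Norm h ≤ l1Norm (θs + h) + l1Norm θs := by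
      simp only [l1Norm, ← Finset.sum_add_distrib]
      refine Finset.sum_le_sum fun i _ => ?_
      have := abs_sub (θs i + h i) (θs i)
      simpa using this
    have h4 : lam * l1Norm h ≤ lam * (l1Norm (θs + h) + l1Norm θs) := by gcongr
    simp only [f, add_zero]
    nlinarith [hpos h]
  obtain ⟨h, hh⟩ : ∃ h, ∀ g, f h ≤ f g := by
    -- With this radius `lam/2 * R` equals the loss `2 * lam * ‖θs‖₁` in `hlow`, so points outside
    -- the sup-norm ball cannot beat `h = 0`.
    set R := 4 * l1Norm θs
    have hR : 0 ≤ R := by have := l1Norm_nonneg θs; positivity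
    obtain ⟨h, -, hh⟩ := (isCompact_closedBall (0 : Fin d → ℝ) R).exists_isMinOn
      ⟨0, by simpa using hR⟩ hf.continuousOn
    refine ⟨h, fun g => ?_⟩
    by_cases hg : g ∈ Metric.closedBall (0 : Fin d → ℝ) R
    · exact hh hg
    · refine (hh (show (0 : Fin d → ℝ) ∈ Metric.closedBall 0 R by simpa using hR)).trans ?_
      have hg1 : R < l1Norm g := by
        rw [mem_closedBall_zero_iff, not_le] at hg
        refine hg.trans_le ?_
        refine (pi_norm_le_iff_of_nonneg (l1Norm_nonneg g)).2 fun i => ?_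
        exact Finset.single_le_sum (f := fun i => |g i|) (fun _ _ => abs_nonneg _)
          (Finset.mem_univ i)
      have := hlow g
      change f 0 ≤ f g
      nlinarith
  refine ⟨θs + h, Set.mem_univ _, fun g _ => ?_⟩
  have := hh (g - θs)
  simpa [f] using this

/-- The cone condition and the basic inequality of the generalized Lasso. -/
theorem generalizedLasso_basic (Q : Matrix (Fin d) (Fin d) ℝ) (hQ : Q.IsSymm)
    (hpos : ∀ h : Fin d → ℝ, 0 ≤ h ⬝ᵥ (Q *ᵥ h)) (b θs θh : Fin d → ℝ) {lam : ℝ} (hlam : 0 < lam)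
    {s : ℕ} (hs : IsSparse s θs) (hb : ∀ i, |(b - Q *ᵥ θs) i| ≤ lam / 2)
    (hθ : θh ∈ generalizedLasso Set.univ Q b lam) :
    l1Norm (θh - θs) ≤ 4 * (Real.sqrt s * l2Norm (θh - θs)) ∧
      (θh - θs) ⬝ᵥ (Q *ᵥ (θh - θs)) ≤ 3 * lam * (Real.sqrt s * l2Norm (θh - θs)) := by
  set h := θh - θs with hh
  have hθh : θh = θs + h := by simp [hh]
  have hmin : lassoObjective Q b lam (θs + h) ≤ lassoObjective Q b lam θs := by
    rw [← hθh]; exact hθ.2 (Set.mem_univ θs)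
  rw [lassoObjective_eq Q hQ] at hmin
  have h2 := (abs_le.1 (abs_dotProduct_le_of_abs_le hb h)).2
  set S := Finset.univ.filter fun i => θs i ≠ 0 with hS
  have h5 := sum_abs_le_sqrt_mul S hs h
  have hsplit : l1Norm h = ∑ i ∈ S, |h i| + ∑ i ∈ Sᶜ, |h i| :=
    (Finset.sum_add_sum_compl S _).symm
  have hdiff : -∑ i ∈ S, |h i| + ∑ i ∈ Sᶜ, |h i| ≤ l1Norm (θs + h) - l1Norm θs := by
    simp only [l1Norm]
    rw [← Finset.sum_sub_distrib, ← Finset.sum_add_sum_compl S, ← Finset.sum_neg_distrib]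
    refine add_le_add (Finset.sum_le_sum fun i _ => ?_) (Finset.sum_le_sum fun i hi => ?_)
    · have := abs_sub (θs i + h i) (h i)
      simp only [Pi.add_apply] at this ⊢
      rw [add_sub_cancel_right] at this
      linarith
    · have : θs i = 0 := by simpa [hS] using hi
      simp [this]
  have hdiff' := mul_le_mul_of_nonneg_left hdiff hlam.le
  have hp := hpos h
  have h0 : (0 : ℝ) ≤ ∑ i ∈ Sᶜ, |h i| := Finset.sum_nonneg fun _ _ => abs_nonneg _
  -- The gradient term costs `lam/2` per unit of `ℓ₁` norm. Off the support this leaves `lam -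
  -- lam/2`; on the support it adds up to `lam + lam/2`. The ratio 3 is the cone constant.
  have key : 1 / 2 * (h ⬝ᵥ (Q *ᵥ h)) + lam / 2 * ∑ i ∈ Sᶜ, |h i|
      ≤ 3 / 2 * lam * ∑ i ∈ S, |h i| := by
    rw [hsplit] at h2
    linarith
  have hcone : ∑ i ∈ Sᶜ, |h i| ≤ 3 * ∑ i ∈ S, |h i| := by
    have : lam / 2 * ∑ i ∈ Sᶜ, |h i| ≤ lam / 2 * (3 * ∑ i ∈ S, |h i|) := by linarith
    exact le_of_mul_le_mul_left this (by positivity)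
  constructor
  · linarith
  · have h6 := mul_le_mul_of_nonneg_left h5 hlam.le
    have := mul_nonneg hlam.le h0
    linarith

/-- Curvature on the cone and the basic inequality give `κ/2 * ‖h‖₂² ≤ 3 * lam * √s * ‖h‖₂`; one
factor `‖h‖₂` cancels, and the cone condition converts the result to `ℓ₁`. -/
theorem generalizedLasso_error (Q : Matrix (Fin d) (Fin d) ℝ) (hQ : Q.IsSymm)
    (hpos : ∀ h : Fin d → ℝ, 0 ≤ h ⬝ᵥ (Q *ᵥ h)) (b θs θh : Fin d → ℝ) {lam κ : ℝ}
    (hlam : 0 < lam) (hκ : 0 < κ)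
    {s : ℕ} (hs : IsSparse s θs) (hb : ∀ i, |(b - Q *ᵥ θs) i| ≤ lam / 2)
    (hre : ∀ h, l1Norm h ≤ 4 * (Real.sqrt s * l2Norm h) →
      κ / 2 * l2Norm h ^ 2 ≤ h ⬝ᵥ (Q *ᵥ h))
    (hθ : θh ∈ generalizedLasso Set.univ Q b lam) :
    l2Norm (θh - θs) ≤ 6 * lam / κ * Real.sqrt s ∧
      l1Norm (θh - θs) ≤ 24 * lam / κ * s := by
  obtain ⟨h1, h2⟩ := generalizedLasso_basic Q hQ hpos b θs θh hlam hs hb hθ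
  have h3 := hre _ h1
  set h := θh - θs
  have hn := l2Norm_nonneg h
  have hl2 : l2Norm h ≤ 6 * lam / κ * Real.sqrt s := by
    rcases hn.eq_or_lt with h0 | h0
    · rw [← h0]; positivity
    · have : κ * l2Norm h ≤ 6 * lam * Real.sqrt s := by
        refine le_of_mul_le_mul_right ?_ h0
        linarith
      rw [div_mul_eq_mul_div, le_div_iff₀ hκ]
      linarith
  refine ⟨hl2, h1.trans ?_⟩
  calc 4 * (Real.sqrt s * l2Norm h) ≤ 4 * (Real.sqrt s * (6 * lam / κ * Real.sqrt s)) := by gcongr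
    _ = 24 * lam / κ * (Real.sqrt s * Real.sqrt s) := by ring
    _ = _ := by rw [Real.mul_self_sqrt (Nat.cast_nonneg s)]

end Lasso

/-! ### From sparse vectors to arbitrary vectors -/

section SparseExtension

variable {d : ℕ}

theorem exists_largest_coordinates (f : Fin d → ℝ) :
    ∀ s ≤ d, ∃ T : Finset (Fin d), T.card = s ∧ ∀ i ∈ T, ∀ j ∉ T, f j ≤ f i := by
  intro s
  induction s with
  | zero => exact fun _ => ⟨∅, by simp, by simp⟩
  | succ s ih =>
    intro hs
    obtain ⟨T, hT, hTf⟩ := ih (by omega)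
    have hne : (Tᶜ).Nonempty := by
      rw [← Finset.card_pos, Finset.card_compl, Fintype.card_fin]
      omega
    obtain ⟨j, hj, hjm⟩ := Finset.exists_max_image Tᶜ f hne
    rw [Finset.mem_compl] at hj
    refine ⟨insert j T, by rw [Finset.card_insert_of_notMem hj, hT], fun i hi k hk => ?_⟩
    rw [Finset.mem_insert, not_or] at hk
    rcases Finset.mem_insert.1 hi with rfl | hi
    · exact hjm k (by simpa using hk.2)
    · exact hTf i hi k hk.2

/-- Splits off the `s` largest coordinates of a vector that is not `s`-sparse. -/
theorem exists_split_largest {s : ℕ} (hs : 1 ≤ s) (v : Fin d → ℝ) (hv : ¬ IsSparse s v) :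
    ∃ a b : Fin d → ℝ, v = a + b ∧ IsSparse s a ∧ (∀ i, |b i| ≤ l1Norm a / s) ∧
      l1Norm v = l1Norm a + l1Norm b ∧ l2Norm a ≤ l2Norm v ∧
      (∀ r, (∀ i, |v i| ≤ r) → l2Norm a ≤ Real.sqrt s * r) ∧
      (Finset.univ.filter fun i => b i ≠ 0).card < (Finset.univ.filter fun i => v i ≠ 0).card := by
  have hs0 : (0 : ℝ) < s := by exact_mod_cast hs
  have hsd : s ≤ d := by
    rw [IsSparse, not_le] at hv
    exact hv.le.trans ((Finset.card_le_univ _).trans_eq (Fintype.card_fin d))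
  obtain ⟨T, hT, hTv⟩ := exists_largest_coordinates (fun i => |v i|) s hsd
  set a : Fin d → ℝ := fun i => if i ∈ T then v i else 0 with ha
  set b : Fin d → ℝ := fun i => if i ∈ T then 0 else v i with hb
  have ha1 : l1Norm a = ∑ i ∈ T, |v i| := by
    simp only [l1Norm, ha, apply_ite abs, abs_zero]
    simp
  have ha2 : l2Norm a ^ 2 = ∑ i ∈ T, v i ^ 2 := by
    rw [l2Norm_sq]
    simp [ha, ite_pow]
  have hbv : ∀ i, |b i| ≤ l1Norm a / s := by
    intro i
    rw [le_div_iff₀ hs0, ha1]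
    by_cases hi : i ∈ T
    · simp only [hb, hi, if_true, abs_zero, zero_mul]
      exact Finset.sum_nonneg fun _ _ => abs_nonneg _
    · simp only [hb, hi, if_false]
      calc |v i| * s = ∑ _j ∈ T, |v i| := by rw [Finset.sum_const, hT, nsmul_eq_mul, mul_comm]
        _ ≤ _ := Finset.sum_le_sum fun j hj => hTv j hj i hi
  refine ⟨a, b, ?_, ?_, hbv, ?_, ?_, ?_, ?_⟩
  · ext i
    by_cases hi : i ∈ T <;> simp [ha, hb, hi]
  · refine (Finset.card_le_card ?_).trans hT.le
    intro i hi
    by_contra hiT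
    simp [ha, hiT] at hi
  · simp only [l1Norm, ← Finset.sum_add_distrib]
    refine Finset.sum_congr rfl fun i _ => ?_
    by_cases hi : i ∈ T <;> simp [ha, hb, hi]
  · refine le_of_sq_le_sq ?_ (l2Norm_nonneg v)
    rw [ha2, l2Norm_sq]
    exact Finset.sum_le_sum_of_subset_of_nonneg (Finset.subset_univ T)
      fun _ _ _ => sq_nonneg _
  · intro r hr
    have hr0 : 0 ≤ r := by
      obtain ⟨i, -⟩ : T.Nonempty := by rw [← Finset.card_pos]; omega
      exact (abs_nonneg _).trans (hr i)
    refine le_of_sq_le_sq ?_ (by positivity)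
    rw [ha2, mul_pow, Real.sq_sqrt hs0.le]
    calc ∑ i ∈ T, v i ^ 2 ≤ ∑ _i ∈ T, r ^ 2 := by
          refine Finset.sum_le_sum fun i _ => ?_
          rw [← sq_abs]
          exact pow_le_pow_left₀ (abs_nonneg _) (hr i) 2
      _ = s * r ^ 2 := by rw [Finset.sum_const, hT, nsmul_eq_mul]
  · refine Finset.card_lt_card (Finset.ssubset_iff_of_subset ?_ |>.2 ?_)
    · intro i
      by_cases hi : i ∈ T <;> simp [hb, hi]
    -- If no entry of `v` on `T` were non-zero, its largest entries would vanish, so `v = 0` would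
    -- be sparse.
    · by_contra hcon
      push Not at hcon
      have h0 : ∀ i ∈ T, v i = 0 := by
        intro i hi
        by_contra hvi
        have := hcon i (by simpa using hvi)
        simp [hb, hi] at this
      obtain ⟨j, hj⟩ : T.Nonempty := by rw [← Finset.card_pos]; omega
      have hall : ∀ i, v i = 0 := by
        intro i
        by_cases hi : i ∈ T
        · exact h0 i hi
        · have := hTv j hj i hi
          rw [h0 j hj, abs_zero] at this
          exact abs_nonpos_iff.1 this
      exact hv (by simp [IsSparse, hall])

/-- Peeling: remove the `s` largest entries and recurse on the size of the support. The remaining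
entries are at most the mean `‖a‖₁ / s` of the removed block, so the next block has `ℓ₂` norm at
most `‖a‖₁ / √s`. Each block thus pays for its successor, and the payments sum to at most `‖v‖₁ /
√s`; only the first block is charged to `r`. -/
theorem le_of_sparse_bound_of_abs_le {s : ℕ} (hs : 1 ≤ s) {η : ℝ} (hη : 0 ≤ η)
    (p : (Fin d → ℝ) → ℝ) (hadd : ∀ a b, p (a + b) ≤ p a + p b)
    (hp : ∀ u, IsSparse s u → p u ≤ η * l2Norm u) (v : Fin d → ℝ) (r : ℝ) (hr0 : 0 ≤ r)
    (hr : ∀ i, |v i| ≤ r) : p v ≤ η * (Real.sqrt s * r + l1Norm v / Real.sqrt s) := by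
  have hs0 : (0 : ℝ) < s := by exact_mod_cast hs
  have hss : 0 < Real.sqrt s := Real.sqrt_pos.2 hs0
  induction hk : (Finset.univ.filter fun i => v i ≠ 0).card using Nat.strong_induction_on
    generalizing v r with
  | _ k ih =>
  by_cases hv : IsSparse s v
  · refine (hp v hv).trans (mul_le_mul_of_nonneg_left ?_ hη)
    have : l2Norm v ≤ Real.sqrt s * r := by
      refine le_of_sq_le_sq ?_ (by positivity)
      rw [l2Norm_sq, mul_pow, Real.sq_sqrt hs0.le]
      calc ∑ i, v i ^ 2 = ∑ i ∈ Finset.univ.filter (fun i => v i ≠ 0), v i ^ 2 := by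
            rw [Finset.sum_filter]
            exact Finset.sum_congr rfl fun i _ => by by_cases h : v i = 0 <;> simp [h]
        _ ≤ ∑ _i ∈ Finset.univ.filter (fun i => v i ≠ 0), r ^ 2 := by
          refine Finset.sum_le_sum fun i _ => ?_
          rw [← sq_abs]
          exact pow_le_pow_left₀ (abs_nonneg _) (hr i) 2
        _ ≤ s * r ^ 2 := by
          rw [Finset.sum_const, nsmul_eq_mul]
          have : ((Finset.univ.filter fun i => v i ≠ 0).card : ℝ) ≤ s := by exact_mod_cast hv
          gcongr
    have := div_nonneg (l1Norm_nonneg v) hss.le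
    linarith
  · obtain ⟨a, b, hab, ha, hb, h1, -, h2, hcard⟩ := exists_split_largest hs v hv
    have hr' : 0 ≤ l1Norm a / s := div_nonneg (l1Norm_nonneg a) hs0.le
    have hpb := ih _ (hk ▸ hcard) b _ hr' hb rfl
    have hpa := (hp a ha).trans (mul_le_mul_of_nonneg_left (h2 r hr) hη)
    have hsq : Real.sqrt s * (l1Norm a / s) = l1Norm a / Real.sqrt s := by
      rw [mul_comm, div_mul, Real.div_sqrt]
    rw [hsq] at hpb
    calc p v ≤ p a + p b := by rw [hab]; exact hadd a b
      _ ≤ _ := by rw [h1, add_div]; linarith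

/-- A subadditive functional which is controlled on sparse vectors is controlled everywhere. -/
theorem le_of_sparse_bound {s : ℕ} (hs : 1 ≤ s) {η : ℝ} (hη : 0 ≤ η)
    (p : (Fin d → ℝ) → ℝ) (hadd : ∀ a b, p (a + b) ≤ p a + p b)
    (hp : ∀ u, IsSparse s u → p u ≤ η * l2Norm u) (v : Fin d → ℝ) :
    p v ≤ η * (l2Norm v + l1Norm v / Real.sqrt s) := by
  have hs0 : (0 : ℝ) < s := by exact_mod_cast hs
  have hss : 0 < Real.sqrt s := Real.sqrt_pos.2 hs0
  by_cases hv : IsSparse s v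
  · refine (hp v hv).trans (mul_le_mul_of_nonneg_left ?_ hη)
    have := div_nonneg (l1Norm_nonneg v) hss.le
    linarith
  · obtain ⟨a, b, hab, ha, hb, h1, h2, -, -⟩ := exists_split_largest hs v hv
    have hpb := le_of_sparse_bound_of_abs_le hs hη p hadd hp b _
      (div_nonneg (l1Norm_nonneg a) hs0.le) hb
    have hpa := (hp a ha).trans (mul_le_mul_of_nonneg_left h2 hη)
    have hsq : Real.sqrt s * (l1Norm a / s) = l1Norm a / Real.sqrt s := by
      rw [mul_comm, div_mul, Real.div_sqrt]
    rw [hsq] at hpb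
    calc p v ≤ p a + p b := by rw [hab]; exact hadd a b
      _ ≤ _ := by rw [h1, add_div]; linarith

/-- The sparse extension is applied once in each argument, the other argument being frozen; each
application contributes one factor `‖v‖₂ + ‖v‖₁ / √s`. -/
theorem bilinear_le_of_sparse_bound {s : ℕ} (hs : 1 ≤ s) {η : ℝ} (hη : 0 ≤ η)
    (D : Matrix (Fin d) (Fin d) ℝ)
    (hD : ∀ u w, IsSparse s u → IsSparse s w → |u ⬝ᵥ (D *ᵥ w)| ≤ η * l2Norm u * l2Norm w)
    (v : Fin d → ℝ) :
    |v ⬝ᵥ (D *ᵥ v)| ≤ η * (l2Norm v + l1Norm v / Real.sqrt s) ^ 2 := by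
  set q := l2Norm v + l1Norm v / Real.sqrt s
  have hq : 0 ≤ q :=
    add_nonneg (l2Norm_nonneg v) (div_nonneg (l1Norm_nonneg v) (Real.sqrt_nonneg _))
  have h1 : ∀ u, IsSparse s u → |u ⬝ᵥ (D *ᵥ v)| ≤ η * q * l2Norm u := by
    intro u hu
    have := le_of_sparse_bound hs (mul_nonneg hη (l2Norm_nonneg u)) (fun w => |u ⬝ᵥ (D *ᵥ w)|)
      (fun a b => by
        simp only [Matrix.mulVec_add, dotProduct_add]
        exact abs_add_le _ _) (fun w hw => hD u w hu hw) v
    refine this.trans_eq ?_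
    ring
  have := le_of_sparse_bound hs (mul_nonneg hη hq) (fun u => |u ⬝ᵥ (D *ᵥ v)|)
    (fun a b => by
      simp only [add_dotProduct]
      exact abs_add_le _ _) h1 v
  refine this.trans_eq ?_
  ring

end SparseExtension

/-! ### Half-nets of unit balls on coordinate subspaces -/

section Net

variable {d : ℕ}

/-- A `1/2`-separated subset of the unit ball of largest cardinality is a net, since an uncovered
point could be added. Doubling it gives a 1-separated set in the ball of radius 2, to which the
volume bound `5 ^ dim` applies. -/
theorem exists_half_net (E : Type*) [NormedAddCommGroup E] [NormedSpace ℝ E]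
    [FiniteDimensional ℝ E] :
    ∃ N : Finset E, N.card ≤ 5 ^ Module.finrank ℝ E ∧ (∀ u ∈ N, ‖u‖ ≤ 1) ∧
      ∀ v : E, ‖v‖ ≤ 1 → ∃ u ∈ N, ‖v - u‖ ≤ 1 / 2 := by
  classical
  let P : ℕ → Prop := fun k => ∃ N : Finset E, N.card = k ∧ (∀ u ∈ N, ‖u‖ ≤ 1) ∧
    ∀ u ∈ N, ∀ v ∈ N, u ≠ v → 1 / 2 ≤ ‖u - v‖
  have hbound : ∀ N : Finset E, (∀ u ∈ N, ‖u‖ ≤ 1) →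
      (∀ u ∈ N, ∀ v ∈ N, u ≠ v → 1 / 2 ≤ ‖u - v‖) → N.card ≤ 5 ^ Module.finrank ℝ E := by
    intro N h1 h2
    have hinj : Function.Injective fun u : E => (2 : ℝ) • u :=
      smul_right_injective E (two_ne_zero)
    rw [← Finset.card_image_of_injective N hinj]
    refine Besicovitch.card_le_of_separated _ ?_ ?_
    · simp only [Finset.mem_image, forall_exists_index, and_imp, forall_apply_eq_imp_iff₂,
        norm_smul, Real.norm_ofNat]
      intro u hu
      linarith [h1 u hu]
    · simp only [Finset.mem_image, forall_exists_index, and_imp, forall_apply_eq_imp_iff₂]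
      intro u hu v hv huv
      rw [← smul_sub, norm_smul, Real.norm_ofNat]
      linarith [h2 u hu v hv (by rintro rfl; exact huv rfl)]
  have hP0 : P 0 := ⟨∅, by simp⟩
  obtain ⟨N, hN, h1, h2⟩ : P (Nat.findGreatest P (5 ^ Module.finrank ℝ E)) :=
    Nat.findGreatest_spec (Nat.zero_le _) hP0
  refine ⟨N, hbound N h1 h2, h1, fun v hv => ?_⟩
  by_contra! hcon
  have hvN : v ∉ N := fun h => by
    have := hcon v h
    norm_num at this
  have h1' : ∀ u ∈ insert v N, ‖u‖ ≤ 1 := by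
    intro u hu
    rcases Finset.mem_insert.1 hu with rfl | hu
    · exact hv
    · exact h1 u hu
  have h2' : ∀ u ∈ insert v N, ∀ w ∈ insert v N, u ≠ w → 1 / 2 ≤ ‖u - w‖ := by
    intro u hu w hw huw
    rcases Finset.mem_insert.1 hu with hu' | hu' <;> rcases Finset.mem_insert.1 hw with hw' | hw'
    · exact absurd (hu'.trans hw'.symm) huw
    · rw [hu']; exact (hcon w hw').le
    · rw [hw', norm_sub_rev]; exact (hcon u hu').le
    · exact h2 u hu' w hw' huw
  have hc := Finset.card_insert_of_notMem hvN
  have := Nat.le_findGreatest (hbound _ h1' h2') (show P _ from ⟨insert v N, rfl, h1', h2'⟩)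
  omega

theorem exists_half_net_supported (S : Finset (Fin d)) :
    ∃ N : Finset (Fin d → ℝ), N.card ≤ 5 ^ S.card ∧
      (∀ u ∈ N, l2Norm u ≤ 1 ∧ ∀ i ∉ S, u i = 0) ∧
      ∀ v : Fin d → ℝ, (∀ i ∉ S, v i = 0) → l2Norm v ≤ 1 → ∃ u ∈ N, l2Norm (v - u) ≤ 1 / 2 := by
  classical
  obtain ⟨N, hN, h1, h2⟩ := exists_half_net (EuclideanSpace ℝ S)
  rw [finrank_euclideanSpace, Fintype.card_coe] at hN
  let ext : EuclideanSpace ℝ S → Fin d → ℝ := fun u i => if h : i ∈ S then u ⟨i, h⟩ else 0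
  have hext : ∀ u, l2Norm (ext u) = ‖u‖ := by
    intro u
    rw [EuclideanSpace.norm_eq, l2Norm]
    congr 1
    rw [← Finset.sum_subset (Finset.subset_univ S), ← Finset.sum_attach]
    · exact Finset.sum_congr rfl fun i _ => by simp [ext]
    · intro i _ hi
      simp [ext, hi]
  refine ⟨N.image ext, Finset.card_image_le.trans hN, ?_, ?_⟩
  · simp only [Finset.mem_image, forall_exists_index, and_imp, forall_apply_eq_imp_iff₂]
    exact fun u hu => ⟨(hext u).trans_le (h1 u hu), fun i hi => by simp [ext, hi]⟩
  · intro v hv hv1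
    let v' : EuclideanSpace ℝ S := WithLp.toLp 2 fun i => v i
    have hvv : ext v' = v := by
      ext i
      by_cases hi : i ∈ S <;> simp [ext, v', hi]
      exact (hv i hi).symm
    obtain ⟨u, hu, huv⟩ := h2 v' (by rwa [← hext, hvv])
    refine ⟨ext u, Finset.mem_image_of_mem _ hu, ?_⟩
    rw [← hext] at huv
    convert huv using 2
    rw [← hvv]
    ext i
    by_cases hi : i ∈ S <;> simp [ext, hi]

/-- A finite set of vectors supported in `S` which is a `1/2`-net of the unit ball. -/
noncomputable def halfNet (S : Finset (Fin d)) : Finset (Fin d → ℝ) :=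
  (exists_half_net_supported S).choose

theorem card_halfNet_le (S : Finset (Fin d)) : (halfNet S).card ≤ 5 ^ S.card :=
  (exists_half_net_supported S).choose_spec.1

theorem l2Norm_le_one_of_mem_halfNet {S : Finset (Fin d)} {u : Fin d → ℝ} (hu : u ∈ halfNet S) :
    l2Norm u ≤ 1 :=
  ((exists_half_net_supported S).choose_spec.2.1 u hu).1

theorem eq_zero_of_mem_halfNet {S : Finset (Fin d)} {u : Fin d → ℝ} (hu : u ∈ halfNet S)
    {i : Fin d} (hi : i ∉ S) : u i = 0 :=
  ((exists_half_net_supported S).choose_spec.2.1 u hu).2 i hi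

theorem exists_mem_halfNet {S : Finset (Fin d)} {v : Fin d → ℝ} (hv : ∀ i ∉ S, v i = 0)
    (hv1 : l2Norm v ≤ 1) : ∃ u ∈ halfNet S, l2Norm (v - u) ≤ 1 / 2 :=
  (exists_half_net_supported S).choose_spec.2.2 v hv hv1

/-- Let `a` be the restriction of `g` to `S`. Replacing `a / ‖a‖₂` by a net point changes the
pairing with `a` by at most `‖a‖₂ / 2`, so `‖a‖₂ ≤ t + ‖a‖₂ / 2`. This is the source of the factor
2. -/
theorem abs_dotProduct_le_of_halfNet {S : Finset (Fin d)} {g : Fin d → ℝ} {t : ℝ}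
    (hg : ∀ u ∈ halfNet S, |u ⬝ᵥ g| ≤ t) {v : Fin d → ℝ} (hv : ∀ i ∉ S, v i = 0) :
    |v ⬝ᵥ g| ≤ 2 * t * l2Norm v := by
  classical
  set a : Fin d → ℝ := fun i => if i ∈ S then g i else 0 with ha
  have hag : ∀ w : Fin d → ℝ, (∀ i ∉ S, w i = 0) → w ⬝ᵥ g = w ⬝ᵥ a := by
    intro w hw
    refine Finset.sum_congr rfl fun i _ => ?_
    by_cases hi : i ∈ S
    · simp [ha, hi]
    · simp [hw i hi]
  have ha0 : ∀ i ∉ S, a i = 0 := fun i hi => by simp [ha, hi]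
  have hnorm : l2Norm a ≤ 2 * t := by
    set r := l2Norm a with hr
    rcases (l2Norm_nonneg a).eq_or_lt with h0 | h0
    · obtain ⟨u, hu, -⟩ := exists_mem_halfNet (S := S) (v := 0) (fun _ _ => rfl)
        (by simp [l2Norm])
      rw [hr, ← h0]
      linarith [(abs_nonneg _).trans (hg u hu)]
    · rw [← hr] at h0
      obtain ⟨u, hu, huv⟩ := exists_mem_halfNet (S := S) (v := r⁻¹ • a)
        (fun i hi => by simp [ha0 i hi])
        (by rw [l2Norm_smul, abs_of_pos (inv_pos.2 h0), ← hr, inv_mul_cancel₀ h0.ne'])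
      have h1 : (r⁻¹ • a) ⬝ᵥ a = r := by
        have : a ⬝ᵥ a = r ^ 2 := by
          rw [hr, l2Norm_sq]
          exact Finset.sum_congr rfl fun i _ => (sq _).symm
        rw [smul_dotProduct, this, smul_eq_mul]
        field_simp
      have h2 : (r⁻¹ • a) ⬝ᵥ a = u ⬝ᵥ a + (r⁻¹ • a - u) ⬝ᵥ a := by
        rw [sub_dotProduct]; ring
      have h3 := (le_abs_self _).trans (hg u hu)
      rw [hag u fun i hi => eq_zero_of_mem_halfNet hu hi] at h3
      have h4 := (le_abs_self _).trans (abs_dotProduct_le (r⁻¹ • a - u) a)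
      have h5 : l2Norm (r⁻¹ • a - u) * l2Norm a ≤ 1 / 2 * r :=
        mul_le_mul_of_nonneg_right huv h0.le
      linarith
  rw [hag v hv]
  refine (abs_dotProduct_le v a).trans ?_
  rw [mul_comm]
  exact mul_le_mul_of_nonneg_right hnorm (l2Norm_nonneg v)

theorem abs_bilinear_le_of_halfNet {S T : Finset (Fin d)} {D : Matrix (Fin d) (Fin d) ℝ} {t : ℝ}
    (hD : ∀ u ∈ halfNet S, ∀ w ∈ halfNet T, |u ⬝ᵥ (D *ᵥ w)| ≤ t) {u w : Fin d → ℝ}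
    (hu : ∀ i ∉ S, u i = 0) (hw : ∀ i ∉ T, w i = 0) :
    |u ⬝ᵥ (D *ᵥ w)| ≤ 4 * t * l2Norm u * l2Norm w := by
  have h1 : ∀ u ∈ halfNet S, |u ⬝ᵥ (D *ᵥ w)| ≤ 2 * t * l2Norm w := by
    intro u hu
    rw [Matrix.dotProduct_mulVec, dotProduct_comm]
    refine abs_dotProduct_le_of_halfNet (fun w hw => ?_) hw
    rw [dotProduct_comm, ← Matrix.dotProduct_mulVec]
    exact hD u hu w hw
  refine (abs_dotProduct_le_of_halfNet h1 hu).trans_eq ?_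
  ring

/-- Supports are indexed by arbitrary maps `Fin s → Fin d`, not necessarily injective, so that the
union bound counts simply `d ^ s` of them. -/
theorem exists_image_superset {s : ℕ} (hd : 1 ≤ d) {u : Fin d → ℝ}
    (hu : IsSparse s u) : ∃ f : Fin s → Fin d, ∀ i ∉ Finset.univ.image f, u i = 0 := by
  classical
  set S := Finset.univ.filter fun i => u i ≠ 0 with hS
  let e := S.equivFin
  refine ⟨fun j => if h : (j : ℕ) < S.card then e.symm ⟨j, h⟩ else ⟨0, hd⟩, fun i hi => ?_⟩
  by_contra hui
  refine hi (Finset.mem_image.2 ?_)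
  have hiS : i ∈ S := by simpa [hS] using hui
  refine ⟨⟨e ⟨i, hiS⟩, (e ⟨i, hiS⟩).2.trans_le hu⟩, Finset.mem_univ _, ?_⟩
  simp

end Net

/-! ### A Bernstein inequality under weighted second moments -/

section Bernstein

theorem exp_le_one_add_add_sq_mul_exp_abs (x : ℝ) :
    Real.exp x ≤ 1 + x + x ^ 2 * Real.exp |x| := by
  have h := Complex.norm_exp_sub_sum_le_norm_mul_exp (x : ℂ) 2
  have h2 : Complex.exp x - ∑ m ∈ Finset.range 2, (x : ℂ) ^ m / m.factorial
      = ((Real.exp x - (1 + x) : ℝ) : ℂ) := by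
    simp [Finset.sum_range_succ]
  rw [h2, Complex.norm_real, Complex.norm_real, Real.norm_eq_abs, Real.norm_eq_abs, sq_abs] at h
  linarith [le_abs_self (Real.exp x - (1 + x))]

variable {Ω : Type*} [MeasurableSpace Ω] {μ : Measure Ω}

theorem memLp_two_of_integrable_sq_mul_exp {Z : Ω → ℝ} (hZ : Measurable Z) {lam : ℝ}
    (hlam : 0 ≤ lam) (hint : Integrable (fun ω => Z ω ^ 2 * Real.exp (lam * |Z ω|)) μ) :
    MemLp Z 2 μ := by
  rw [memLp_two_iff_integrable_sq hZ.aestronglyMeasurable]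
  refine hint.mono' (by fun_prop) (ae_of_all _ fun ω => ?_)
  rw [Real.norm_of_nonneg (sq_nonneg _)]
  exact le_mul_of_one_le_right (sq_nonneg _) (Real.one_le_exp (by positivity))

variable [IsProbabilityMeasure μ]

theorem exp_mul_le_of_abs_eq {lam a z : ℝ} (ha : |a| = lam) :
    Real.exp (a * z) ≤ 1 + a * z + lam ^ 2 * (z ^ 2 * Real.exp (lam * |z|)) := by
  have := exp_le_one_add_add_sq_mul_exp_abs (a * z)
  rw [abs_mul, ha] at this
  rw [← ha, sq_abs]
  rw [← ha] at this
  linarith [mul_pow a z 2, congrArg (· * Real.exp (|a| * |z|)) (mul_pow a z 2)]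

theorem integrable_exp_mul_of_integrable_sq_mul_exp {Z : Ω → ℝ} (hZ : Measurable Z) {lam a : ℝ}
    (hlam : 0 ≤ lam) (ha : |a| = lam)
    (hint : Integrable (fun ω => Z ω ^ 2 * Real.exp (lam * |Z ω|)) μ) :
    Integrable (fun ω => Real.exp (a * Z ω)) μ := by
  have h1 := (memLp_two_of_integrable_sq_mul_exp hZ hlam hint).integrable one_le_two
  refine Integrable.mono' (g := fun ω => 1 + a * Z ω
    + lam ^ 2 * (Z ω ^ 2 * Real.exp (lam * |Z ω|))) ?_ (by fun_prop) (ae_of_all _ fun ω => ?_)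
  · exact ((integrable_const _).add (h1.const_mul a)).add (hint.const_mul _)
  · rw [Real.norm_of_nonneg (Real.exp_pos _).le]
    exact exp_mul_le_of_abs_eq ha

/-- Integrating `exp x ≤ 1 + x + x² exp |x|` leaves the mean as the only first-order term. Since `1
+ u ≤ exp u`, centering cancels it and only the quadratic term survives. -/
theorem mgf_centered_le {Z : Ω → ℝ} (hZ : Measurable Z) {lam V a : ℝ}
    (hlam : 0 ≤ lam) (ha : |a| = lam)
    (hint : Integrable (fun ω => Z ω ^ 2 * Real.exp (lam * |Z ω|)) μ)
    (hV : ∫ ω, Z ω ^ 2 * Real.exp (lam * |Z ω|) ∂μ ≤ V) :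
    mgf (fun ω => Z ω - ∫ ω', Z ω' ∂μ) μ a ≤ Real.exp (lam ^ 2 * V) := by
  have h1 := (memLp_two_of_integrable_sq_mul_exp hZ hlam hint).integrable one_le_two
  set e := ∫ ω', Z ω' ∂μ with he
  have h2 : ∫ ω, Real.exp (a * Z ω) ∂μ ≤ 1 + a * e + lam ^ 2 * V := by
    calc ∫ ω, Real.exp (a * Z ω) ∂μ
        ≤ ∫ ω, (1 + a * Z ω + lam ^ 2 * (Z ω ^ 2 * Real.exp (lam * |Z ω|))) ∂μ :=
          integral_mono (integrable_exp_mul_of_integrable_sq_mul_exp hZ hlam ha hint)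
            (((integrable_const _).add (h1.const_mul a)).add (hint.const_mul _))
            fun ω => exp_mul_le_of_abs_eq ha
      _ = 1 + a * e + lam ^ 2 * ∫ ω, Z ω ^ 2 * Real.exp (lam * |Z ω|) ∂μ := by
          rw [integral_add, integral_add, integral_const_mul, integral_const_mul]
          · simp [he]
          · exact integrable_const _
          · exact h1.const_mul a
          · exact (integrable_const _).add (h1.const_mul a)
          · exact hint.const_mul _
      _ ≤ _ := by gcongr
  have h3 : mgf (fun ω => Z ω - e) μ a = Real.exp (-(a * e)) * ∫ ω, Real.exp (a * Z ω) ∂μ := by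
    rw [mgf, ← integral_const_mul]
    congr 1 with ω
    rw [← Real.exp_add]
    ring_nf
  rw [h3]
  calc Real.exp (-(a * e)) * ∫ ω, Real.exp (a * Z ω) ∂μ
      ≤ Real.exp (-(a * e)) * Real.exp (a * e + lam ^ 2 * V) := by
        gcongr
        linarith [Real.add_one_le_exp (a * e + lam ^ 2 * V)]
    _ = _ := by rw [← Real.exp_add]; ring_nf

/-- A Bernstein inequality: exponential concentration of a sum of independent variables whose
exponentially weighted second moments are bounded. -/
theorem measure_sum_sub_integral_ge_le {n : ℕ} {Z : Fin n → Ω → ℝ} (hind : iIndepFun Z μ)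
    (hZ : ∀ k, Measurable (Z k)) {lam V : ℝ} (hlam : 0 ≤ lam)
    (hint : ∀ k, Integrable (fun ω => Z k ω ^ 2 * Real.exp (lam * |Z k ω|)) μ)
    (hV : ∀ k, ∫ ω, Z k ω ^ 2 * Real.exp (lam * |Z k ω|) ∂μ ≤ V) (t : ℝ) :
    μ.real {ω | t ≤ |∑ k, (Z k ω - ∫ ω', Z k ω' ∂μ)|}
      ≤ 2 * Real.exp (n * (lam ^ 2 * V) - lam * t) := by
  set W : Fin n → Ω → ℝ := fun k ω => Z k ω - ∫ ω', Z k ω' ∂μ with hW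
  have hWm : ∀ k, Measurable (W k) := fun k => (hZ k).sub_const _
  have hWind : iIndepFun W μ :=
    hind.comp (fun k z => z - ∫ ω', Z k ω' ∂μ) fun k => measurable_id.sub_const _
  have hWint : ∀ a, |a| = lam → ∀ k, Integrable (fun ω => Real.exp (a * W k ω)) μ := by
    intro a ha k
    have := (integrable_exp_mul_of_integrable_sq_mul_exp (hZ k) hlam ha (hint k)).const_mul
      (Real.exp (-(a * ∫ ω', Z k ω' ∂μ)))
    refine this.congr (ae_of_all _ fun ω => ?_)
    simp only [hW]
    rw [← Real.exp_add]
    ring_nf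
  have hsum : ∀ a, |a| = lam → Integrable (fun ω => Real.exp (a * (∑ k, W k) ω)) μ ∧
      mgf (∑ k, W k) μ a ≤ Real.exp (n * (lam ^ 2 * V)) := by
    intro a ha
    refine ⟨hWind.integrable_exp_mul_sum hWm fun k _ => hWint a ha k, ?_⟩
    rw [hWind.mgf_sum hWm]
    calc ∏ k, mgf (W k) μ a ≤ ∏ _k : Fin n, Real.exp (lam ^ 2 * V) :=
          Finset.prod_le_prod (fun _ _ => mgf_nonneg)
            fun k _ => mgf_centered_le (hZ k) hlam ha (hint k) (hV k)
      _ = _ := by rw [Finset.prod_const, Finset.card_univ, Fintype.card_fin, ← Real.exp_nat_mul]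
  obtain ⟨hi1, hm1⟩ := hsum lam (abs_of_nonneg hlam)
  obtain ⟨hi2, hm2⟩ := hsum (-lam) (by rw [abs_neg, abs_of_nonneg hlam])
  have h1 := measure_ge_le_exp_mul_mgf (X := ∑ k, W k) t hlam hi1
  have h2 := measure_le_le_exp_mul_mgf (X := ∑ k, W k) (-t) (neg_nonpos.2 hlam) hi2
  have hle : μ.real {ω | t ≤ |∑ k, W k ω|} ≤
      μ.real {ω | t ≤ (∑ k, W k) ω} + μ.real {ω | (∑ k, W k) ω ≤ -t} := by
    refine (measureReal_mono ?_).trans (measureReal_union_le _ _)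
    intro ω hω
    simp only [Finset.sum_apply]
    rcases le_abs.1 (show t ≤ |∑ k, W k ω| from hω) with h | h
    · exact Or.inl h
    · exact Or.inr (show ∑ k, W k ω ≤ -t by linarith)
  have he : Real.exp (n * (lam ^ 2 * V) - lam * t)
      = Real.exp (-lam * t) * Real.exp (n * (lam ^ 2 * V)) := by
    rw [← Real.exp_add]; ring_nf
  refine hle.trans ?_
  rw [he, two_mul]
  refine add_le_add (h1.trans ?_) (h2.trans ?_)
  · gcongr
  · rw [show - -lam * -t = -lam * t by ring]
    gcongr

end Bernstein

/-! ### Sub-Gaussian variables and products of two of them -/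

section Subgaussian

variable {Ω : Type*} [MeasurableSpace Ω] {μ : Measure Ω}

/-- `E exp (X² / K²) ≤ 2`. -/
def IsSubgaussian (μ : Measure Ω) (K : ℝ) (X : Ω → ℝ) : Prop :=
  Integrable (fun ω => Real.exp (X ω ^ 2 / K ^ 2)) μ ∧
    ∫ ω, Real.exp (X ω ^ 2 / K ^ 2) ∂μ ≤ 2

/-- Doubling `σ` avoids asking whether the infimum is attained: some admissible `t` lies strictly
below `2 * σ`, and the exponential moment decreases in the scale. -/
theorem isSubgaussian_of_psi2Norm_le {X : Ω → ℝ} (hX : Measurable X) {σ : ℝ} (hσ : 0 < σ)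
    (h : psi2Norm μ X ≤ ENNReal.ofReal σ) : IsSubgaussian μ (2 * σ) X := by
  have hlt : psi2Norm μ X < ENNReal.ofReal (2 * σ) :=
    h.trans_lt ((ENNReal.ofReal_lt_ofReal_iff (by positivity)).2 (by linarith))
  simp only [psi2Norm, iInf_lt_iff] at hlt
  obtain ⟨t, ht0, ht, htσ⟩ := hlt
  rw [ENNReal.ofReal_lt_ofReal_iff (by positivity)] at htσ
  have hle : ∫⁻ ω, ENNReal.ofReal (Real.exp (X ω ^ 2 / (2 * σ) ^ 2)) ∂μ ≤ 2 := by
    refine (lintegral_mono fun ω => ?_).trans ht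
    gcongr
  have hint : Integrable (fun ω => Real.exp (X ω ^ 2 / (2 * σ) ^ 2)) μ := by
    refine ⟨by fun_prop, ?_⟩
    rw [hasFiniteIntegral_iff_ofReal (ae_of_all _ fun ω => (Real.exp_pos _).le)]
    exact hle.trans_lt (by simp)
  refine ⟨hint, ?_⟩
  rw [integral_eq_lintegral_of_nonneg_ae (ae_of_all _ fun ω => (Real.exp_pos _).le)
    hint.aestronglyMeasurable]
  exact ENNReal.toReal_le_of_le_ofReal (by norm_num) (by simpa using hle)

theorem isSubgaussian_dotProduct [IsProbabilityMeasure μ] {d : ℕ} {X : Ω → Fin d → ℝ}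
    (hX : Measurable X) {σ : ℝ} (hσ : 0 < σ) (h : psi2NormVec μ X ≤ ENNReal.ofReal σ)
    {v : Fin d → ℝ} (hv : l2Norm v ≤ 1) :
    IsSubgaussian μ (2 * σ) fun ω => v ⬝ᵥ X ω := by
  have hm : ∀ w : Fin d → ℝ, Measurable fun ω => w ⬝ᵥ X ω := by
    intro w
    simp only [dotProduct]
    fun_prop
  rcases (l2Norm_nonneg v).eq_or_lt with h0 | h0
  · simp [IsSubgaussian, l2Norm_eq_zero h0.symm]
  · set w := (l2Norm v)⁻¹ • v with hw
    have hw1 : l2Norm w = 1 := by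
      rw [hw, l2Norm_smul, abs_of_pos (inv_pos.2 h0), inv_mul_cancel₀ h0.ne']
    have hvw : v = l2Norm v • w := by rw [hw, smul_smul, mul_inv_cancel₀ h0.ne', one_smul]
    have hps : psi2Norm μ (fun ω => w ⬝ᵥ X ω) ≤ ENNReal.ofReal σ :=
      (le_iSup₂ (f := fun (v : Fin d → ℝ) (_ : l2Norm v = 1) =>
        psi2Norm μ fun ω => v ⬝ᵥ X ω) w hw1).trans h
    obtain ⟨h1, h2⟩ := isSubgaussian_of_psi2Norm_le (hm w) hσ hps
    have hle : ∀ ω, Real.exp ((v ⬝ᵥ X ω) ^ 2 / (2 * σ) ^ 2)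
        ≤ Real.exp ((w ⬝ᵥ X ω) ^ 2 / (2 * σ) ^ 2) := by
      intro ω
      refine Real.exp_le_exp.2 (div_le_div_of_nonneg_right ?_ (by positivity))
      nth_rewrite 1 [hvw]
      rw [smul_dotProduct, smul_eq_mul, mul_pow]
      exact mul_le_of_le_one_left (sq_nonneg _) (pow_le_one₀ h0.le hv)
    have hi : Integrable (fun ω => Real.exp ((v ⬝ᵥ X ω) ^ 2 / (2 * σ) ^ 2)) μ := by
      have := hm v
      refine h1.mono' (by fun_prop) (ae_of_all _ fun ω => ?_)
      rw [Real.norm_of_nonneg (Real.exp_pos _).le]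
      exact hle ω
    exact ⟨hi, (integral_mono hi h1 hle).trans h2⟩

variable {K : ℝ} {X Y : Ω → ℝ}

theorem IsSubgaussian.integrable_sq [IsProbabilityMeasure μ] (hX : Measurable X) (hK : 0 < K)
    (h : IsSubgaussian μ K X) :
    Integrable (fun ω => X ω ^ 2) μ ∧ ∫ ω, X ω ^ 2 ∂μ ≤ K ^ 2 := by
  have hle : ∀ ω, X ω ^ 2 ≤ K ^ 2 * (Real.exp (X ω ^ 2 / K ^ 2) - 1) := by
    intro ω
    have := Real.add_one_le_exp (X ω ^ 2 / K ^ 2)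
    calc X ω ^ 2 = K ^ 2 * (X ω ^ 2 / K ^ 2) := by field_simp
      _ ≤ _ := by gcongr; linarith
  have hint : Integrable (fun ω => K ^ 2 * (Real.exp (X ω ^ 2 / K ^ 2) - 1)) μ :=
    (h.1.sub (integrable_const _)).const_mul _
  have hi : Integrable (fun ω => X ω ^ 2) μ := by
    refine hint.mono' (by fun_prop) (ae_of_all _ fun ω => ?_)
    rw [Real.norm_of_nonneg (sq_nonneg _)]
    exact hle ω
  refine ⟨hi, (integral_mono hi hint hle).trans ?_⟩
  rw [integral_const_mul, integral_sub h.1 (integrable_const _)]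
  simp only [integral_const, probReal_univ, smul_eq_mul, one_mul]
  nlinarith [h.2, sq_nonneg K]

theorem IsSubgaussian.memLp_two [IsProbabilityMeasure μ] (hX : Measurable X) (hK : 0 < K)
    (h : IsSubgaussian μ K X) :
    MemLp X 2 μ :=
  (memLp_two_iff_integrable_sq hX.aestronglyMeasurable).2 (h.integrable_sq hX hK).1

theorem sq_mul_exp_half_le {w : ℝ} (hw : 0 ≤ w) :
    w ^ 2 * Real.exp (w / 2) ≤ 8 * Real.exp w := by
  have h1 := Real.quadratic_le_exp_of_nonneg (x := w / 2) (by positivity)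
  have h2 : Real.exp w = Real.exp (w / 2) * Real.exp (w / 2) := by
    rw [← Real.exp_add]; ring_nf
  rw [h2, ← mul_assoc]
  refine mul_le_mul_of_nonneg_right ?_ (Real.exp_pos _).le
  nlinarith

/-- With `w = |XY| / K²`, the inequality `2|XY| ≤ X² + Y²` bounds `exp w` by the mean of the two
exponential moments. The restriction on `lam` spends only `w/2` of the exponent; the other half
absorbs `w²`. -/
theorem IsSubgaussian.product_moment (hX : Measurable X) (hY : Measurable Y) (hK : 0 < K)
    (hXs : IsSubgaussian μ K X) (hYs : IsSubgaussian μ K Y) {lam : ℝ}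
    (hlam : lam ≤ 1 / (2 * K ^ 2)) :
    Integrable (fun ω => (X ω * Y ω) ^ 2 * Real.exp (lam * |X ω * Y ω|)) μ ∧
      ∫ ω, (X ω * Y ω) ^ 2 * Real.exp (lam * |X ω * Y ω|) ∂μ ≤ 16 * K ^ 4 := by
  have hle : ∀ ω, (X ω * Y ω) ^ 2 * Real.exp (lam * |X ω * Y ω|) ≤
      4 * K ^ 4 * (Real.exp (X ω ^ 2 / K ^ 2) + Real.exp (Y ω ^ 2 / K ^ 2)) := by
    intro ω
    set a := X ω ^ 2 / K ^ 2 with ha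
    set b := Y ω ^ 2 / K ^ 2 with hb
    set w := |X ω * Y ω| / K ^ 2 with hw
    have hw0 : 0 ≤ w := by positivity
    have hwab : w ≤ (a + b) / 2 := by
      rw [hw, ha, hb, ← add_div, div_right_comm]
      gcongr
      rw [abs_mul, ← sq_abs (X ω), ← sq_abs (Y ω)]
      nlinarith [sq_nonneg (|X ω| - |Y ω|)]
    have h1 : (X ω * Y ω) ^ 2 = K ^ 4 * w ^ 2 := by
      rw [hw, div_pow, sq_abs]
      field_simp
    have h2 : lam * |X ω * Y ω| ≤ w / 2 := by
      calc lam * |X ω * Y ω| ≤ 1 / (2 * K ^ 2) * |X ω * Y ω| := by gcongr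
        _ = w / 2 := by rw [hw]; field_simp
    have h3 : Real.exp w ≤ (Real.exp a + Real.exp b) / 2 := by
      have h4 : Real.exp w ≤ Real.exp (a / 2) * Real.exp (b / 2) := by
        rw [← Real.exp_add]
        exact Real.exp_le_exp.2 (by linarith)
      have h5 : Real.exp a = Real.exp (a / 2) ^ 2 := by rw [← Real.exp_nat_mul]; ring_nf
      have h6 : Real.exp b = Real.exp (b / 2) ^ 2 := by rw [← Real.exp_nat_mul]; ring_nf
      rw [h5, h6]
      nlinarith [sq_nonneg (Real.exp (a / 2) - Real.exp (b / 2))]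
    calc (X ω * Y ω) ^ 2 * Real.exp (lam * |X ω * Y ω|)
        ≤ K ^ 4 * w ^ 2 * Real.exp (w / 2) := by rw [h1]; gcongr
      _ = K ^ 4 * (w ^ 2 * Real.exp (w / 2)) := by ring
      _ ≤ K ^ 4 * (8 * ((Real.exp a + Real.exp b) / 2)) := by
          have := sq_mul_exp_half_le hw0
          exact mul_le_mul_of_nonneg_left (by linarith) (by positivity)
      _ = _ := by ring
  have hint : Integrable (fun ω =>
      4 * K ^ 4 * (Real.exp (X ω ^ 2 / K ^ 2) + Real.exp (Y ω ^ 2 / K ^ 2))) μ :=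
    (hXs.1.add hYs.1).const_mul _
  have hi : Integrable (fun ω => (X ω * Y ω) ^ 2 * Real.exp (lam * |X ω * Y ω|)) μ := by
    refine hint.mono' (by fun_prop) (ae_of_all _ fun ω => ?_)
    rw [Real.norm_of_nonneg (by positivity)]
    exact hle ω
  refine ⟨hi, (integral_mono hi hint hle).trans ?_⟩
  rw [integral_const_mul, integral_add hXs.1 hYs.1]
  have := hXs.2
  have := hYs.2
  calc _ ≤ 4 * K ^ 4 * (2 + 2) := by gcongr
    _ = _ := by ring

/-- Concentration of averages of products of subgaussian variables. -/
theorem measure_sum_mul_ge_le [IsProbabilityMeasure μ] {n : ℕ} {X Y : Fin n → Ω → ℝ}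
    (hind : iIndepFun (fun k ω => X k ω * Y k ω) μ)
    (hX : ∀ k, Measurable (X k)) (hY : ∀ k, Measurable (Y k)) (hK : 0 < K)
    (hXs : ∀ k, IsSubgaussian μ K (X k)) (hYs : ∀ k, IsSubgaussian μ K (Y k)) {t : ℝ}
    (ht0 : 0 ≤ t) (ht : t ≤ 16 * K ^ 2) :
    μ.real {ω | n * t ≤ |∑ k, (X k ω * Y k ω - ∫ ω', X k ω' * Y k ω' ∂μ)|}
      ≤ 2 * Real.exp (-(n * t ^ 2 / (64 * K ^ 4))) := by
  -- This value of `lam` minimizes `16 K⁴ lam² - lam t`, with minimum `-t² / (64 K⁴)`. The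
  -- hypothesis `t ≤ 16 K²` keeps it in the admissible range.
  have hlam : t / (32 * K ^ 4) ≤ 1 / (2 * K ^ 2) := by
    rw [div_le_div_iff₀ (by positivity) (by positivity)]
    nlinarith [sq_nonneg K]
  have h := measure_sum_sub_integral_ge_le hind (fun k => (hX k).mul (hY k))
    (lam := t / (32 * K ^ 4)) (V := 16 * K ^ 4) (by positivity)
    (fun k => ((hXs k).product_moment (hX k) (hY k) hK (hYs k) hlam).1)
    (fun k => ((hXs k).product_moment (hX k) (hY k) hK (hYs k) hlam).2) (n * t)
  refine h.trans_eq ?_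
  congr 2
  field_simp
  ring

end Subgaussian

/-! ### Mixed moments of a heavy-tailed response and a sub-Gaussian covariate -/

section TruncatedMoments

variable {Ω : Type*} [MeasurableSpace Ω] {μ : Measure Ω}

/-- The left side is at most `exp (3 p w)`, and completing the square gives `3 p w ≤ 9 p² / 4 + w²`.
Any fixed power of the weight is therefore covered by the sub-Gaussian moment. -/
theorem rpow_mul_exp_le {w p : ℝ} (hw : 0 ≤ w) (hp : 0 ≤ p) :
    (w ^ 2 * Real.exp w) ^ p ≤ Real.exp (9 * p ^ 2 / 4) * Real.exp (w ^ 2) := by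
  have h1 : w ^ 2 * Real.exp w ≤ Real.exp (3 * w) := by
    have : w ≤ Real.exp w := by linarith [Real.add_one_le_exp w]
    calc w ^ 2 * Real.exp w ≤ Real.exp w ^ 2 * Real.exp w := by gcongr
      _ = _ := by rw [← pow_succ, ← Real.exp_nat_mul]; norm_num
  calc (w ^ 2 * Real.exp w) ^ p ≤ Real.exp (3 * w) ^ p := by gcongr
    _ = Real.exp (3 * w * p) := (Real.exp_mul _ _).symm
    _ ≤ Real.exp (9 * p ^ 2 / 4 + w ^ 2) := by
      refine Real.exp_le_exp.2 ?_
      nlinarith [sq_nonneg (w - 3 * p / 2)]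
    _ = _ := Real.exp_add _ _

theorem rpow_le_exp_mul_exp {w p : ℝ} (hw : 0 ≤ w) (hp : 0 ≤ p) :
    w ^ p ≤ Real.exp (9 * p ^ 2 / 4) * Real.exp (w ^ 2) := by
  have : w ≤ Real.exp w := by linarith [Real.add_one_le_exp w]
  calc w ^ p ≤ Real.exp w ^ p := by gcongr
    _ = Real.exp (w * p) := (Real.exp_mul _ _).symm
    _ ≤ Real.exp (9 * p ^ 2 / 4 + w ^ 2) := by
      refine Real.exp_le_exp.2 ?_
      nlinarith [sq_nonneg (w - p / 2), sq_nonneg p]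
    _ = _ := Real.exp_add _ _

/-- The constant of the moment bounds below, for the conjugate exponent of `l`. -/
noncomputable def momentConst (l : ℝ) : ℝ := Real.exp (9 * (l / (l - 1)) ^ 2 / 4)

theorem one_le_momentConst (l : ℝ) : 1 ≤ momentConst l := Real.one_le_exp (by positivity)

theorem sq_div_sq_rpow {l M : ℝ} (hl : 0 < l) (hM : 0 < M) (y : ℝ) :
    (y ^ 2 / (M ^ (1 / (2 * l))) ^ 2) ^ l = |y| ^ (2 * l) / M := by
  have hm : 0 < M ^ (1 / (2 * l)) := Real.rpow_pos_of_pos hM _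
  rw [Real.div_rpow (sq_nonneg _) (sq_nonneg _), ← sq_abs y, ← Real.rpow_natCast |y| 2,
    ← Real.rpow_natCast _ 2, ← Real.rpow_mul (abs_nonneg _), ← Real.rpow_mul hm.le,
    ← Real.rpow_mul hM.le]
  have : 1 / (2 * l) * (((2 : ℕ) : ℝ) * l) = 1 := by push_cast; field_simp
  rw [this, Real.rpow_one, Nat.cast_ofNat]

theorem sq_mul_le_young {l M y g : ℝ} (hl : 1 < l) (hM : 0 < M) (hg : 0 ≤ g) :
    y ^ 2 * g ≤ (M ^ (1 / (2 * l))) ^ 2 * (|y| ^ (2 * l) / M + g ^ (l / (l - 1))) := by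
  set m := M ^ (1 / (2 * l)) with hm
  have hl0 : 0 < l := by linarith
  have hm0 : 0 < m := Real.rpow_pos_of_pos hM _
  have hconj : l.HolderConjugate (l / (l - 1)) := Real.HolderConjugate.conjExponent hl
  have hp1 : 1 ≤ l / (l - 1) := by rw [le_div_iff₀ (by linarith)]; linarith
  have h := Real.young_inequality_of_nonneg (a := y ^ 2 / m ^ 2) (b := g) (by positivity) hg hconj
  have h1 : (y ^ 2 / m ^ 2) ^ l / l ≤ |y| ^ (2 * l) / M := by
    rw [sq_div_sq_rpow hl0 hM]
    exact div_le_self (by positivity) hl.le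
  have h2 : g ^ (l / (l - 1)) / (l / (l - 1)) ≤ g ^ (l / (l - 1)) :=
    div_le_self (by positivity) hp1
  calc y ^ 2 * g = m ^ 2 * (y ^ 2 / m ^ 2 * g) := by field_simp
    _ ≤ _ := by gcongr; linarith

variable {K l M : ℝ} {X y : Ω → ℝ}

theorem integrable_rpow_of_lintegral_le (hy : Measurable y) (hM : 0 < M)
    (h : ∫⁻ ω, ENNReal.ofReal (|y ω| ^ (2 * l)) ∂μ ≤ ENNReal.ofReal M) :
    Integrable (fun ω => |y ω| ^ (2 * l)) μ ∧ ∫ ω, |y ω| ^ (2 * l) ∂μ ≤ M := by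
  have hnn : ∀ ω, 0 ≤ |y ω| ^ (2 * l) := fun ω => by positivity
  have hint : Integrable (fun ω => |y ω| ^ (2 * l)) μ := by
    refine ⟨(hy.abs.pow_const _).aestronglyMeasurable, ?_⟩
    rw [hasFiniteIntegral_iff_ofReal (ae_of_all _ hnn)]
    exact h.trans_lt ENNReal.ofReal_lt_top
  refine ⟨hint, ?_⟩
  rw [integral_eq_lintegral_of_nonneg_ae (ae_of_all _ hnn) hint.aestronglyMeasurable]
  exact ENNReal.toReal_le_of_le_ofReal hM.le h

/-- Response and covariate are dependent, so Hölder duality is used in the pointwise form of Young: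
the `2l`-th moment handles `y`, and the conjugate power of the weight is absorbed by `exp (X² /
K²)`. -/
theorem integrable_sq_mul_of_moment (hX : Measurable X) (hy : Measurable y) (hl : 1 < l)
    (hM : 0 < M) (hXs : IsSubgaussian μ K X)
    (hyM : Integrable (fun ω => |y ω| ^ (2 * l)) μ ∧ ∫ ω, |y ω| ^ (2 * l) ∂μ ≤ M)
    {g : ℝ → ℝ} (hg : Measurable g) (hg0 : ∀ w, 0 ≤ w → 0 ≤ g w)
    (hgp : ∀ w, 0 ≤ w → g w ^ (l / (l - 1)) ≤ momentConst l * Real.exp (w ^ 2)) :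
    Integrable (fun ω => y ω ^ 2 * g (|X ω / K|)) μ ∧
      ∫ ω, y ω ^ 2 * g (|X ω / K|) ∂μ ≤ 3 * momentConst l * (M ^ (1 / (2 * l))) ^ 2 := by
  set m := M ^ (1 / (2 * l))
  set C := momentConst l
  have hC : 1 ≤ C := one_le_momentConst l
  have hle : ∀ ω, y ω ^ 2 * g (|X ω / K|) ≤
      m ^ 2 * (|y ω| ^ (2 * l) / M + C * Real.exp (X ω ^ 2 / K ^ 2)) := by
    intro ω
    refine (sq_mul_le_young hl hM (hg0 _ (abs_nonneg _))).trans ?_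
    have := hgp _ (abs_nonneg (X ω / K))
    rw [sq_abs, div_pow] at this
    gcongr
  have h1 : Integrable (fun ω => |y ω| ^ (2 * l) / M) μ := hyM.1.div_const _
  have h2 : Integrable (fun ω => C * Real.exp (X ω ^ 2 / K ^ 2)) μ := hXs.1.const_mul _
  have hint : Integrable (fun ω =>
      m ^ 2 * (|y ω| ^ (2 * l) / M + C * Real.exp (X ω ^ 2 / K ^ 2))) μ := (h1.add h2).const_mul _
  have hi : Integrable (fun ω => y ω ^ 2 * g (|X ω / K|)) μ := by
    refine hint.mono' (by fun_prop) (ae_of_all _ fun ω => ?_)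
    rw [Real.norm_of_nonneg (mul_nonneg (sq_nonneg _) (hg0 _ (abs_nonneg _)))]
    exact hle ω
  refine ⟨hi, (integral_mono hi hint hle).trans ?_⟩
  rw [integral_const_mul, integral_add h1 h2, integral_div, integral_const_mul]
  have h3 : (∫ ω, |y ω| ^ (2 * l) ∂μ) / M ≤ 1 := (div_le_one hM).2 hyM.2
  have h4 := mul_le_mul_of_nonneg_left hXs.2 (zero_le_one.trans hC)
  calc _ ≤ m ^ 2 * (1 + C * 2) := by gcongr
    _ ≤ m ^ 2 * (3 * C) := by gcongr; linarith
    _ = _ := by ring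

/-- Young's inequality against the constant 1, keeping the weights `1/l` and `1 - 1/l`, gives
Jensen's bound with constant exactly 1. -/
theorem integrable_sq_of_moment [IsProbabilityMeasure μ] (hy : Measurable y) (hl : 1 < l)
    (hM : 0 < M)
    (hyM : Integrable (fun ω => |y ω| ^ (2 * l)) μ ∧ ∫ ω, |y ω| ^ (2 * l) ∂μ ≤ M) :
    Integrable (fun ω => y ω ^ 2) μ ∧ ∫ ω, y ω ^ 2 ∂μ ≤ (M ^ (1 / (2 * l))) ^ 2 := by
  set m := M ^ (1 / (2 * l)) with hm
  have hl0 : 0 < l := by linarith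
  have hm0 : 0 < m := Real.rpow_pos_of_pos hM _
  have hle : ∀ ω, y ω ^ 2 ≤ m ^ 2 * (|y ω| ^ (2 * l) / M / l + (1 - 1 / l)) := by
    intro ω
    have hconj : l.HolderConjugate (l / (l - 1)) := Real.HolderConjugate.conjExponent hl
    have h := Real.young_inequality_of_nonneg (a := y ω ^ 2 / m ^ 2) (b := 1) (by positivity)
      zero_le_one hconj
    rw [sq_div_sq_rpow hl0 hM, Real.one_rpow, mul_one] at h
    have h1 : 1 / (l / (l - 1)) = 1 - 1 / l := by field_simp
    rw [h1] at h
    calc y ω ^ 2 = m ^ 2 * (y ω ^ 2 / m ^ 2) := by field_simp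
      _ ≤ _ := by gcongr
  have h1 : Integrable (fun ω => |y ω| ^ (2 * l) / M / l) μ := (hyM.1.div_const _).div_const _
  have hint : Integrable (fun ω => m ^ 2 * (|y ω| ^ (2 * l) / M / l + (1 - 1 / l))) μ :=
    (h1.add (integrable_const _)).const_mul _
  have hi : Integrable (fun ω => y ω ^ 2) μ := by
    refine hint.mono' (by fun_prop) (ae_of_all _ fun ω => ?_)
    rw [Real.norm_of_nonneg (sq_nonneg _)]
    exact hle ω
  refine ⟨hi, (integral_mono hi hint hle).trans ?_⟩
  rw [integral_const_mul, integral_add h1 (integrable_const _), integral_div, integral_div]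
  simp only [integral_const, probReal_univ, smul_eq_mul, one_mul]
  have h3 : (∫ ω, |y ω| ^ (2 * l) ∂μ) / M / l ≤ 1 / l := by
    gcongr
    exact (div_le_one hM).2 hyM.2
  calc _ ≤ m ^ 2 * (1 / l + (1 - 1 / l)) := by gcongr
    _ = _ := by ring

end TruncatedMoments

/-! ### Truncation, dithering and quantization -/

section Quantization

theorem measurable_quantizer (Δ : ℝ) : Measurable (quantizer Δ) := by
  unfold quantizer
  by_cases h : Δ = 0
  · simp only [h, if_true]
    exact measurable_id
  · simp only [h, if_false]
    have : Measurable fun a : ℝ => (⌊a / Δ⌋ : ℝ) :=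
      measurable_from_top.comp (Int.measurable_floor.comp (measurable_id.div_const Δ))
    exact (this.add_const _).const_mul _

theorem abs_quantizer_sub_le {Δ : ℝ} (hΔ : 0 ≤ Δ) (a : ℝ) : |quantizer Δ a - a| ≤ Δ / 2 := by
  rcases hΔ.eq_or_lt with rfl | h
  · simp [quantizer]
  · have h1 := Int.floor_le (a / Δ)
    have h2 := Int.lt_floor_add_one (a / Δ)
    rw [le_div_iff₀ h] at h1
    rw [div_lt_iff₀ h] at h2
    rw [quantizer, if_neg h.ne', abs_le]
    constructor <;> linarith

theorem measurable_truncate (ζ : ℝ) : Measurable (truncate ζ) := by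
  have : Measurable Real.sign := by
    unfold Real.sign
    exact Measurable.ite measurableSet_Iio measurable_const
      (Measurable.ite measurableSet_Ioi measurable_const measurable_const)
  unfold truncate
  fun_prop

theorem abs_truncate {ζ : ℝ} (hζ : 0 ≤ ζ) (y : ℝ) : |truncate ζ y| = min |y| ζ := by
  rcases eq_or_ne y 0 with rfl | hy
  · simp [truncate, hζ]
  · have : |Real.sign y| = 1 := by
      rcases Real.sign_apply_eq_of_ne_zero y hy with h | h <;> simp [h]
    rw [truncate, abs_mul, this, one_mul, abs_of_nonneg (le_min (abs_nonneg _) hζ)]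

/-- The difference vanishes for `|y| ≤ ζ`. Otherwise it is at most `|y|`, and the factor `|y| / ζ`
is at least 1. -/
theorem abs_sub_truncate_le {ζ : ℝ} (hζ : 0 < ζ) (y : ℝ) : |y - truncate ζ y| ≤ y ^ 2 / ζ := by
  have h : y - truncate ζ y = Real.sign y * (|y| - min |y| ζ) := by
    rw [truncate, mul_sub]
    congr 1
    rcases lt_trichotomy y 0 with h | rfl | h
    · rw [Real.sign_of_neg h, abs_of_neg h]; ring
    · simp
    · rw [Real.sign_of_pos h, abs_of_pos h, one_mul]
  have hs : |Real.sign y| ≤ 1 := by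
    rcases Real.sign_apply_eq y with h | h | h <;> simp [h]
  rw [h, abs_mul]
  have h0 : 0 ≤ |y| - min |y| ζ := sub_nonneg.2 (min_le_left _ _)
  rw [abs_of_nonneg h0]
  refine (mul_le_of_le_one_left h0 hs).trans ?_
  rw [le_div_iff₀ hζ, ← sq_abs]
  rcases le_total |y| ζ with h1 | h1
  · rw [min_eq_left h1, sub_self, zero_mul]
    positivity
  · rw [min_eq_right h1]
    nlinarith

theorem isProbabilityMeasure_ditherLaw {Δ : ℝ} (hΔ : 0 ≤ Δ) :
    IsProbabilityMeasure (ditherLaw Δ) := by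
  rcases hΔ.eq_or_lt with rfl | h
  · simp only [ditherLaw, if_true]
    infer_instance
  · rw [ditherLaw, if_neg h.ne']
    refine cond_isProbabilityMeasure_of_finite ?_ ?_ <;> simp [Real.volume_Icc, h]

theorem ae_abs_le_ditherLaw {Δ : ℝ} (hΔ : 0 ≤ Δ) : ∀ᵐ t ∂ditherLaw Δ, |t| ≤ Δ / 2 := by
  rcases hΔ.eq_or_lt with rfl | h
  · simp only [ditherLaw, if_true]
    rw [ae_dirac_eq]
    simp
  · rw [ditherLaw, if_neg h.ne']
    filter_upwards [ae_cond_mem (μ := volume)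
      (measurableSet_Icc (a := -(Δ / 2)) (b := Δ / 2))] with t ht
    exact abs_le.2 ht

/-- The integrand is `t + 1/2` minus the fractional part, whose integral over any full period is
`1/2`. -/
theorem integral_floor_add_half (c : ℝ) : ∫ t in c..(c + 1), ((⌊t⌋ : ℝ) + 1 / 2) = c + 1 / 2 := by
  have hper : Function.Periodic (fun t : ℝ => Int.fract t) 1 := fun t => Int.fract_add_one t
  have h1 : ∫ t in c..(c + 1), Int.fract t = 1 / 2 := by
    rw [hper.intervalIntegral_add_eq c 0, zero_add]
    have : ∫ t in (0 : ℝ)..1, Int.fract t = ∫ t in (0 : ℝ)..1, t := by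
      refine intervalIntegral.integral_congr_ae ?_
      have hne : ∀ᵐ t : ℝ, t ≠ 1 := by simp [ae_iff]
      filter_upwards [hne] with t ht hmem
      rw [Set.uIoc_of_le zero_le_one] at hmem
      exact Int.fract_eq_self.2 ⟨hmem.1.le, lt_of_le_of_ne hmem.2 ht⟩
    rw [this, integral_id]
    norm_num
  have hfr : IntervalIntegrable (fun t : ℝ => Int.fract t) volume c (c + 1) := by
    rw [intervalIntegrable_iff]
    refine Measure.integrableOn_of_bounded (M := 1) (by simp) measurable_fract.aestronglyMeasurable
      (ae_of_all _ fun t => ?_)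
    rw [Real.norm_of_nonneg (Int.fract_nonneg t)]
    exact (Int.fract_lt_one t).le
  have h2 : ∀ t : ℝ, (⌊t⌋ : ℝ) + 1 / 2 = (t + 1 / 2) - Int.fract t := by
    intro t
    rw [Int.fract]
    ring
  simp only [h2]
  rw [intervalIntegral.integral_sub (Continuous.intervalIntegrable (by fun_prop) _ _) hfr, h1,
    intervalIntegral.integral_add (Continuous.intervalIntegrable (by fun_prop) _ _)
      (Continuous.intervalIntegrable (by fun_prop) _ _), integral_id]
  simp
  ring

/-- The dithered quantizer is unbiased. -/
theorem integral_quantizer_ditherLaw {Δ : ℝ} (hΔ : 0 ≤ Δ) (a : ℝ) :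
    ∫ t, quantizer Δ (a + t) ∂ditherLaw Δ = a := by
  rcases hΔ.eq_or_lt with rfl | h
  · simp [ditherLaw, quantizer]
  · rw [ditherLaw, if_neg h.ne', ProbabilityTheory.cond, integral_smul_measure,
      integral_Icc_eq_integral_Ioc, ← intervalIntegral.integral_of_le (by linarith)]
    have hq : ∀ t, quantizer Δ (a + t) = Δ * ((⌊a / Δ + t / Δ⌋ : ℝ) + 1 / 2) := by
      intro t
      rw [quantizer, if_neg h.ne', add_div]
    simp only [hq]
    rw [intervalIntegral.integral_const_mul,
      intervalIntegral.integral_comp_add_div (fun t => (⌊t⌋ : ℝ) + 1 / 2) h.ne']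
    -- After rescaling by `Δ` the dither interval becomes a unit interval centred at `a / Δ`.
    have e1 : a / Δ + -(Δ / 2) / Δ = a / Δ - 1 / 2 := by field_simp; ring
    have e2 : a / Δ + Δ / 2 / Δ = a / Δ - 1 / 2 + 1 := by field_simp; ring
    rw [e1, e2, integral_floor_add_half, Real.volume_Icc, ENNReal.toReal_inv,
      ENNReal.toReal_ofReal (by linarith)]
    simp only [smul_eq_mul]
    field_simp
    ring

end Quantization

/-! ### Independence of paired families and averaging over the dither -/

section Independence

variable {Ω : Type*} [MeasurableSpace Ω] {μ : Measure Ω} [IsProbabilityMeasure μ]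

/-- Everything is expressed through laws: a product of two product measures is carried to a product
of pairwise products by exchanging the order of the factors. -/
theorem iIndepFun_prodMk_of_indepFun {n : ℕ} {α β : Type*} [MeasurableSpace α] [MeasurableSpace β]
    {X : Fin n → Ω → α} {Y : Fin n → Ω → β} (hX : ∀ k, Measurable (X k))
    (hY : ∀ k, Measurable (Y k)) (hXi : iIndepFun X μ) (hYi : iIndepFun Y μ)
    (hXY : IndepFun (fun ω k => X k ω) (fun ω k => Y k ω) μ) :
    iIndepFun (fun k ω => (X k ω, Y k ω)) μ := by
  have hXp : ∀ k, IsProbabilityMeasure (μ.map (X k)) :=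
    fun k => Measure.isProbabilityMeasure_map (hX k).aemeasurable
  have hYp : ∀ k, IsProbabilityMeasure (μ.map (Y k)) :=
    fun k => Measure.isProbabilityMeasure_map (hY k).aemeasurable
  have hXm : Measurable fun ω k => X k ω := measurable_pi_lambda _ hX
  have hYm : Measurable fun ω k => Y k ω := measurable_pi_lambda _ hY
  rw [iIndepFun_iff_map_fun_eq_pi_map fun k => ((hX k).prodMk (hY k)).aemeasurable]
  have hk : ∀ k, μ.map (fun ω => (X k ω, Y k ω)) = (μ.map (X k)).prod (μ.map (Y k)) := by
    intro k
    have := hXY.comp (measurable_pi_apply k) (measurable_pi_apply k)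
    exact (indepFun_iff_map_prod_eq_prod_map_map (hX k).aemeasurable (hY k).aemeasurable).1 this
  simp only [hk]
  have hpres := (measurePreserving_arrowProdEquivProdArrow α β (Fin n) (fun k => μ.map (X k))
    (fun k => μ.map (Y k))).symm
  rw [← hpres.map_eq, ← (iIndepFun_iff_map_fun_eq_pi_map fun k => (hX k).aemeasurable).1 hXi,
    ← (iIndepFun_iff_map_fun_eq_pi_map fun k => (hY k).aemeasurable).1 hYi,
    ← (indepFun_iff_map_prod_eq_prod_map_map hXm.aemeasurable hYm.aemeasurable).1 hXY,
    Measure.map_map hpres.measurable (hXm.prodMk hYm)]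
  rfl

/-- An error which averages out over an independent variable is uncorrelated with the rest. -/
theorem integral_mul_eq_zero_of_indepFun {α : Type*} [MeasurableSpace α] {Z : Ω → α} {T : Ω → ℝ}
    (hZ : Measurable Z) (hT : Measurable T) (hZT : IndepFun Z T μ) {f : α → ℝ → ℝ} {g : α → ℝ}
    (hf : Measurable (Function.uncurry f)) (hg : Measurable g)
    (hmean : ∀ z, ∫ t, f z t ∂(μ.map T) = 0)
    (hint : Integrable (fun ω => f (Z ω) (T ω) * g (Z ω)) μ) :
    ∫ ω, f (Z ω) (T ω) * g (Z ω) ∂μ = 0 := by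
  have hTp : IsProbabilityMeasure (μ.map T) := Measure.isProbabilityMeasure_map hT.aemeasurable
  have hZp : IsProbabilityMeasure (μ.map Z) := Measure.isProbabilityMeasure_map hZ.aemeasurable
  have hprod := (indepFun_iff_map_prod_eq_prod_map_map hZ.aemeasurable hT.aemeasurable).1 hZT
  have hm : Measurable fun p : α × ℝ => f p.1 p.2 * g p.1 := hf.mul (hg.comp measurable_fst)
  have hint' : Integrable (fun p : α × ℝ => f p.1 p.2 * g p.1) ((μ.map Z).prod (μ.map T)) := by
    rw [← hprod, integrable_map_measure hm.aestronglyMeasurable (hZ.prodMk hT).aemeasurable]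
    exact hint
  calc ∫ ω, f (Z ω) (T ω) * g (Z ω) ∂μ
      = ∫ p, f p.1 p.2 * g p.1 ∂(μ.map fun ω => (Z ω, T ω)) :=
        (integral_map (hZ.prodMk hT).aemeasurable hm.aestronglyMeasurable).symm
    _ = ∫ z, ∫ t, f z t * g z ∂(μ.map T) ∂(μ.map Z) := by
        rw [hprod, integral_prod _ hint']
    _ = 0 := by simp [integral_mul_const, hmean]

end Independence

/-! ### Quadratic forms of sample and population covariances -/

section SecondMoments

variable {Ω : Type*} [MeasurableSpace Ω] {μ : Measure Ω} {n d : ℕ}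

theorem measurable_dotProduct_left (v : Fin d → ℝ) {X : Ω → Fin d → ℝ} (hX : Measurable X) :
    Measurable fun ω => v ⬝ᵥ X ω := by
  simp only [dotProduct]
  fun_prop

theorem dotProduct_sampleCov_mulVec (x : Fin n → Fin d → ℝ) (u w : Fin d → ℝ) :
    u ⬝ᵥ (sampleCov x *ᵥ w) = (1 / (n : ℝ)) * ∑ k, (u ⬝ᵥ x k) * (w ⬝ᵥ x k) := by
  rw [sampleCov, Matrix.smul_mulVec, dotProduct_smul, Matrix.sum_mulVec, dotProduct_sum,
    smul_eq_mul]
  congr 1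
  refine Finset.sum_congr rfl fun k _ => ?_
  rw [Matrix.vecMulVec_mulVec, dotProduct_comm (x k) w]
  simp [dotProduct_smul, mul_comm]

theorem isSymm_sampleCov (x : Fin n → Fin d → ℝ) : (sampleCov x).IsSymm := by
  ext i j
  simp [sampleCov, Matrix.sum_apply, Matrix.vecMulVec_apply, mul_comm]

theorem sampleCov_nonneg (x : Fin n → Fin d → ℝ) (h : Fin d → ℝ) :
    0 ≤ h ⬝ᵥ (sampleCov x *ᵥ h) := by
  rw [dotProduct_sampleCov_mulVec]
  exact mul_nonneg (by positivity) (Finset.sum_nonneg fun _ _ => mul_self_nonneg _)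

theorem dotProduct_secondMoment_mulVec {X : Ω → Fin d → ℝ}
    (hX : ∀ i, MemLp (fun ω => X ω i) 2 μ) (u w : Fin d → ℝ) :
    u ⬝ᵥ (secondMoment μ X *ᵥ w) = ∫ ω, (u ⬝ᵥ X ω) * (w ⬝ᵥ X ω) ∂μ := by
  have hint : ∀ i j, Integrable (fun ω => X ω i * X ω j) μ := fun i j =>
    (hX i).integrable_mul (hX j)
  have h1 : ∀ ω, (u ⬝ᵥ X ω) * (w ⬝ᵥ X ω) = ∑ i, ∑ j, u i * w j * (X ω i * X ω j) := by
    intro ω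
    simp only [dotProduct, Finset.sum_mul_sum]
    exact Finset.sum_congr rfl fun i _ => Finset.sum_congr rfl fun j _ => by ring
  simp only [h1]
  rw [integral_finsetSum _ fun i _ => integrable_finsetSum _ fun j _ => (hint i j).const_mul _]
  simp only [dotProduct, Matrix.mulVec, secondMoment, Matrix.of_apply, Finset.mul_sum]
  refine Finset.sum_congr rfl fun i _ => ?_
  rw [integral_finsetSum _ fun j _ => (hint i j).const_mul _]
  refine Finset.sum_congr rfl fun j _ => ?_
  rw [integral_const_mul]
  ring

theorem le_quadratic_of_spectrum_subset {A : Matrix (Fin d) (Fin d) ℝ} (hA : A.IsSymm) {a b : ℝ}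
    (h : spectrum ℝ A ⊆ Set.Icc a b) (v : Fin d → ℝ) :
    a * l2Norm v ^ 2 ≤ v ⬝ᵥ (A *ᵥ v) := by
  have hps : (A - algebraMap ℝ _ a).PosSemidef := by
    rw [Matrix.posSemidef_iff_isHermitian_and_spectrum_nonneg]
    constructor
    · have h1 : A.IsHermitian := by
        rwa [Matrix.IsHermitian, Matrix.conjTranspose_eq_transpose_of_trivial]
      refine h1.sub ?_
      rw [Algebra.algebraMap_eq_smul_one]
      simp [Matrix.IsHermitian]
    · intro r hr
      rw [← spectrum.sub_singleton_eq] at hr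
      obtain ⟨q, hq, c, hc, rfl⟩ := Set.mem_sub.1 hr
      rw [Set.mem_singleton_iff] at hc
      have := (h hq).1
      simp [hc, this]
  have := hps.dotProduct_mulVec_nonneg v
  rw [Matrix.sub_mulVec, dotProduct_sub, Algebra.algebraMap_eq_smul_one, Matrix.smul_mulVec,
    Matrix.one_mulVec, dotProduct_smul] at this
  have hvv : v ⬝ᵥ v = l2Norm v ^ 2 := by
    rw [l2Norm_sq]
    exact Finset.sum_congr rfl fun i _ => (sq _).symm
  simp only [star_trivial, hvv, smul_eq_mul] at this
  linarith

end SecondMoments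

/-! ### Restricted eigenvalues by a union bound over sparse nets -/

section RestrictedEigenvalue

variable {Ω : Type*} [MeasurableSpace Ω] {μ : Measure Ω} {n d : ℕ}

/-- The event that `(1/n) ∑ (uᵀx_k)(wᵀx_k)` deviates by at least `t` from its mean. -/
def deviationEvent (μ : Measure Ω) (x : Fin n → Ω → Fin d → ℝ) (t : ℝ) (u w : Fin d → ℝ) : Set Ω :=
  {ω | n * t ≤ |∑ k, ((u ⬝ᵥ x k ω) * (w ⬝ᵥ x k ω)
    - ∫ ω', (u ⬝ᵥ x k ω') * (w ⬝ᵥ x k ω') ∂μ)|}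

theorem measurableSet_deviationEvent {x : Fin n → Ω → Fin d → ℝ} (hx : ∀ k, Measurable (x k))
    (t : ℝ) (u w : Fin d → ℝ) : MeasurableSet (deviationEvent μ x t u w) := by
  have := fun k => measurable_dotProduct_left u (hx k)
  have := fun k => measurable_dotProduct_left w (hx k)
  exact measurableSet_le measurable_const (by fun_prop)

theorem measure_deviationEvent_le [IsProbabilityMeasure μ] {x : Fin n → Ω → Fin d → ℝ}
    (hx : ∀ k, Measurable (x k))
    (hind : iIndepFun x μ) {K : ℝ} (hK : 0 < K)
    (hsub : ∀ k v, l2Norm v ≤ 1 → IsSubgaussian μ K fun ω => v ⬝ᵥ x k ω) {t : ℝ}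
    (ht0 : 0 ≤ t) (ht : t ≤ 16 * K ^ 2) {u w : Fin d → ℝ} (hu : l2Norm u ≤ 1)
    (hw : l2Norm w ≤ 1) :
    μ.real (deviationEvent μ x t u w) ≤ 2 * Real.exp (-(n * t ^ 2 / (64 * K ^ 4))) := by
  refine measure_sum_mul_ge_le ?_ (fun k => measurable_dotProduct_left u (hx k))
    (fun k => measurable_dotProduct_left w (hx k)) hK (fun k => hsub k u hu)
    (fun k => hsub k w hw) ht0 ht
  exact hind.comp (fun _ z => (u ⬝ᵥ z) * (w ⬝ᵥ z)) fun _ =>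
    (measurable_dotProduct_left u measurable_id).mul (measurable_dotProduct_left w measurable_id)

/-- The event that the sample covariance deviates from its mean on some net of sparse vectors. -/
def sparseDeviationEvent (μ : Measure Ω) (x : Fin n → Ω → Fin d → ℝ) (t : ℝ) (s : ℕ) : Set Ω :=
  ⋃ p : (Fin s → Fin d) × (Fin s → Fin d),
    ⋃ q ∈ halfNet (Finset.univ.image p.1) ×ˢ halfNet (Finset.univ.image p.2),
      deviationEvent μ x t q.1 q.2

theorem measurableSet_sparseDeviationEvent {x : Fin n → Ω → Fin d → ℝ}
    (hx : ∀ k, Measurable (x k)) (t : ℝ) (s : ℕ) :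
    MeasurableSet (sparseDeviationEvent μ x t s) :=
  MeasurableSet.iUnion fun _ => Finset.measurableSet_biUnion _ fun _ _ =>
    measurableSet_deviationEvent hx _ _ _

theorem measure_sparseDeviationEvent_le [IsProbabilityMeasure μ] {x : Fin n → Ω → Fin d → ℝ}
    (hx : ∀ k, Measurable (x k))
    (hind : iIndepFun x μ) {K : ℝ} (hK : 0 < K)
    (hsub : ∀ k v, l2Norm v ≤ 1 → IsSubgaussian μ K fun ω => v ⬝ᵥ x k ω) {t : ℝ}
    (ht0 : 0 ≤ t) (ht : t ≤ 16 * K ^ 2) (s : ℕ) :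
    μ.real (sparseDeviationEvent μ x t s)
      ≤ (d * 5 : ℝ) ^ (2 * s) * (2 * Real.exp (-(n * t ^ 2 / (64 * K ^ 4)))) := by
  set P := 2 * Real.exp (-(n * t ^ 2 / (64 * K ^ 4))) with hP
  have hcard : ∀ f : Fin s → Fin d, ((halfNet (Finset.univ.image f)).card : ℝ) ≤ 5 ^ s := by
    intro f
    have h1 := card_halfNet_le (Finset.univ.image f)
    have h2 : (Finset.univ.image f).card ≤ s := Finset.card_image_le.trans (by simp)
    exact_mod_cast h1.trans (Nat.pow_le_pow_right (by norm_num) h2)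
  refine (measureReal_iUnion_fintype_le _).trans ?_
  calc ∑ p : (Fin s → Fin d) × (Fin s → Fin d), μ.real
        (⋃ q ∈ halfNet (Finset.univ.image p.1) ×ˢ halfNet (Finset.univ.image p.2),
          deviationEvent μ x t q.1 q.2)
      ≤ ∑ _p : (Fin s → Fin d) × (Fin s → Fin d), (5 : ℝ) ^ s * 5 ^ s * P := by
        refine Finset.sum_le_sum fun p _ => ?_
        refine (measureReal_biUnion_finset_le _ _).trans ?_
        calc _ ≤ ∑ _q ∈ halfNet (Finset.univ.image p.1) ×ˢ halfNet (Finset.univ.image p.2), P := by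
              refine Finset.sum_le_sum fun q hq => ?_
              rw [Finset.mem_product] at hq
              exact measure_deviationEvent_le hx hind hK hsub ht0 ht
                (l2Norm_le_one_of_mem_halfNet hq.1) (l2Norm_le_one_of_mem_halfNet hq.2)
          _ ≤ _ := by
              rw [Finset.sum_const, Finset.card_product, nsmul_eq_mul, Nat.cast_mul]
              gcongr
              · exact hcard p.1
              · exact hcard p.2
    _ = _ := by
        rw [Finset.sum_const, Finset.card_univ, nsmul_eq_mul]
        simp only [Fintype.card_prod, Fintype.card_fun, Fintype.card_fin, Nat.cast_mul,
          Nat.cast_pow]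
        ring

/-- The restricted eigenvalue property of the sample covariance on the cone of the Lasso. -/
theorem restricted_eigenvalue {x : Fin n → Ω → Fin d → ℝ} (hn : 0 < n) (hd : 1 ≤ d) {s : ℕ}
    (hs : 1 ≤ s) (hmem : ∀ k i, MemLp (fun ω => x k ω i) 2 μ) {κ : ℝ} (hκ : 0 < κ)
    (hlow : ∀ k v, κ * l2Norm v ^ 2 ≤ v ⬝ᵥ (secondMoment μ (x k) *ᵥ v)) {ω : Ω}
    (hω : ω ∉ sparseDeviationEvent μ x (κ / 200) s) {h : Fin d → ℝ}
    (hh : l1Norm h ≤ 4 * (Real.sqrt s * l2Norm h)) :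
    κ / 2 * l2Norm h ^ 2 ≤ h ⬝ᵥ (sampleCov (fun k => x k ω) *ᵥ h) := by
  have hn0 : (0 : ℝ) < n := by exact_mod_cast hn
  have hs0 : (0 : ℝ) < s := by exact_mod_cast hs
  set Sg : Matrix (Fin d) (Fin d) ℝ := (1 / (n : ℝ)) • ∑ k, secondMoment μ (x k) with hSg
  have hSgd : ∀ u w, u ⬝ᵥ (Sg *ᵥ w) = (1 / (n : ℝ)) * ∑ k, u ⬝ᵥ (secondMoment μ (x k) *ᵥ w) := by
    intro u w
    rw [hSg, Matrix.smul_mulVec, dotProduct_smul, Matrix.sum_mulVec, dotProduct_sum, smul_eq_mul]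
  set D := sampleCov (fun k => x k ω) - Sg with hD
  have hnet : ∀ f g : Fin s → Fin d, ∀ u ∈ halfNet (Finset.univ.image f),
      ∀ w ∈ halfNet (Finset.univ.image g), |u ⬝ᵥ (D *ᵥ w)| ≤ κ / 200 := by
    intro f g u hu w hw
    have hnot : ω ∉ deviationEvent μ x (κ / 200) u w := by
      intro hcon
      refine hω (Set.mem_iUnion.2 ⟨(f, g), Set.mem_iUnion₂.2 ⟨(u, w), ?_, hcon⟩⟩)
      exact Finset.mem_product.2 ⟨hu, hw⟩
    have hlt : |∑ k, ((u ⬝ᵥ x k ω) * (w ⬝ᵥ x k ω)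
        - ∫ ω', (u ⬝ᵥ x k ω') * (w ⬝ᵥ x k ω') ∂μ)| < n * (κ / 200) := not_le.1 hnot
    rw [hD, Matrix.sub_mulVec, dotProduct_sub, dotProduct_sampleCov_mulVec, hSgd, ← mul_sub,
      ← Finset.sum_sub_distrib, abs_mul, abs_of_pos (by positivity), one_div, inv_mul_le_iff₀ hn0]
    simp only [dotProduct_secondMoment_mulVec (hmem _)]
    exact hlt.le
  -- The constants: two nets cost a factor 4, and the cone gives `‖h‖₂ + ‖h‖₁ / √s ≤ 5 ‖h‖₂`. The
  -- deviation is at most `4 * 25 * κ / 200 = κ / 2` times `‖h‖₂²`, half of the population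
  -- curvature.
  have hbil := bilinear_le_of_sparse_bound hs (η := 4 * (κ / 200)) (by positivity) D
    (fun u w hu hw => by
      obtain ⟨f, hf⟩ := exists_image_superset hd hu
      obtain ⟨g, hg⟩ := exists_image_superset hd hw
      exact abs_bilinear_le_of_halfNet (hnet f g) hf hg) h
  have hq : l2Norm h + l1Norm h / Real.sqrt s ≤ 5 * l2Norm h := by
    have : l1Norm h / Real.sqrt s ≤ 4 * l2Norm h := by
      rw [div_le_iff₀ (Real.sqrt_pos.2 hs0)]
      linarith
    linarith
  have hq0 : 0 ≤ l2Norm h + l1Norm h / Real.sqrt s :=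
    add_nonneg (l2Norm_nonneg h) (div_nonneg (l1Norm_nonneg h) (Real.sqrt_nonneg _))
  have hq2 := pow_le_pow_left₀ hq0 hq 2
  have hSh : κ * l2Norm h ^ 2 ≤ h ⬝ᵥ (Sg *ᵥ h) := by
    rw [hSgd, one_div, ← div_eq_inv_mul, le_div_iff₀ hn0]
    calc κ * l2Norm h ^ 2 * n = ∑ _k : Fin n, κ * l2Norm h ^ 2 := by
          rw [Finset.sum_const, Finset.card_univ, Fintype.card_fin, nsmul_eq_mul, mul_comm]
      _ ≤ _ := Finset.sum_le_sum fun k _ => hlow k h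
  rw [hD, Matrix.sub_mulVec, dotProduct_sub] at hbil
  have h1 := (abs_le.1 hbil).1
  have h2 : 4 * (κ / 200) * (l2Norm h + l1Norm h / Real.sqrt s) ^ 2
      ≤ 4 * (κ / 200) * (5 * l2Norm h) ^ 2 := by gcongr
  nlinarith

end RestrictedEigenvalue

/-! ### Bias and concentration of the quantized response -/

section Response

variable {Ω : Type*} [MeasurableSpace Ω] {μ : Measure Ω} {K l M ζ Δ : ℝ} {X y z : Ω → ℝ}

/-- The two bounds on `z` play different roles. The uniform one enters only the exponent, where it
gives `lam * |z X| ≤ |X| / K`; the square is bounded through `|y| + Δ`, so the variance proxy does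
not depend on `ζ`. -/
theorem bounded_response_moment (hX : Measurable X) (hy : Measurable y) (hz : Measurable z)
    (hl : 1 < l) (hM : 0 < M) (hK : 0 < K) (hζ : 0 < ζ) (hΔ : 0 ≤ Δ) (hXs : IsSubgaussian μ K X)
    (hyM : Integrable (fun ω => |y ω| ^ (2 * l)) μ ∧ ∫ ω, |y ω| ^ (2 * l) ∂μ ≤ M)
    (hzy : ∀ᵐ ω ∂μ, |z ω| ≤ |y ω| + Δ) (hzζ : ∀ᵐ ω ∂μ, |z ω| ≤ ζ + Δ) {lam : ℝ}
    (hlam : lam ≤ 1 / (K * (ζ + Δ))) :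
    Integrable (fun ω => (z ω * X ω) ^ 2 * Real.exp (lam * |z ω * X ω|)) μ ∧
      ∫ ω, (z ω * X ω) ^ 2 * Real.exp (lam * |z ω * X ω|) ∂μ
        ≤ 6 * momentConst l * K ^ 2 * (M ^ (1 / (2 * l)) + Δ) ^ 2 := by
  set m := M ^ (1 / (2 * l)) with hm
  set C := momentConst l with hC
  have hC1 : 1 ≤ C := one_le_momentConst l
  have hm0 : 0 < m := Real.rpow_pos_of_pos hM _
  have hp1 : 1 ≤ l / (l - 1) := by rw [le_div_iff₀ (by linarith)]; linarith
  set g : ℝ → ℝ := fun w => w ^ 2 * Real.exp w with hg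
  have hgm : Measurable g := by fun_prop
  obtain ⟨hi1, hb1⟩ := integrable_sq_mul_of_moment hX hy hl hM hXs hyM hgm
    (fun w hw => by positivity) (fun w hw => rpow_mul_exp_le hw (zero_le_one.trans hp1))
  have hg1 : ∀ ω, g |X ω / K| ≤ C * Real.exp (X ω ^ 2 / K ^ 2) := by
    intro ω
    have h := rpow_mul_exp_le (w := |X ω / K|) (abs_nonneg _) zero_le_one
    rw [Real.rpow_one, sq_abs, div_pow] at h
    simp only [hg, sq_abs, div_pow]
    refine h.trans (mul_le_mul_of_nonneg_right (Real.exp_le_exp.2 ?_) (Real.exp_pos _).le)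
    have : (1 : ℝ) ^ 2 ≤ (l / (l - 1)) ^ 2 := pow_le_pow_left₀ zero_le_one hp1 2
    linarith
  have hdom : ∀ᵐ ω ∂μ, (z ω * X ω) ^ 2 * Real.exp (lam * |z ω * X ω|) ≤
      2 * K ^ 2 * (y ω ^ 2 * g |X ω / K| + Δ ^ 2 * (C * Real.exp (X ω ^ 2 / K ^ 2))) := by
    filter_upwards [hzy, hzζ] with ω h1 h2
    set w := |X ω / K| with hw
    have hXw : |X ω| = K * w := by
      rw [hw, abs_div, abs_of_pos hK]
      field_simp
    have hw0 : 0 ≤ w := abs_nonneg _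
    have he : lam * |z ω * X ω| ≤ w := by
      calc lam * |z ω * X ω| ≤ 1 / (K * (ζ + Δ)) * ((ζ + Δ) * (K * w)) := by
            rw [abs_mul, hXw]
            gcongr
        _ = w := by field_simp
    have hzz : z ω ^ 2 ≤ 2 * (y ω ^ 2 + Δ ^ 2) := by
      rw [← sq_abs (z ω), ← sq_abs (y ω)]
      have := pow_le_pow_left₀ (abs_nonneg _) h1 2
      nlinarith [sq_nonneg (|y ω| - Δ)]
    calc (z ω * X ω) ^ 2 * Real.exp (lam * |z ω * X ω|)
        = z ω ^ 2 * (K * w) ^ 2 * Real.exp (lam * |z ω * X ω|) := by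
          rw [mul_pow, ← sq_abs (X ω), hXw]
      _ ≤ 2 * (y ω ^ 2 + Δ ^ 2) * (K * w) ^ 2 * Real.exp w := by gcongr
      _ = 2 * K ^ 2 * (y ω ^ 2 * g w + Δ ^ 2 * g w) := by simp only [hg]; ring
      _ ≤ _ := by
        have := hg1 ω
        gcongr
  have hi2 : Integrable (fun ω => Δ ^ 2 * (C * Real.exp (X ω ^ 2 / K ^ 2))) μ :=
    (hXs.1.const_mul _).const_mul _
  have hint := (hi1.add hi2).const_mul (2 * K ^ 2)
  have hi : Integrable (fun ω => (z ω * X ω) ^ 2 * Real.exp (lam * |z ω * X ω|)) μ := by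
    refine hint.mono' (by fun_prop) ?_
    filter_upwards [hdom] with ω hω
    rw [Real.norm_of_nonneg (by positivity)]
    exact hω
  refine ⟨hi, (integral_mono_ae hi hint hdom).trans ?_⟩
  simp only [Pi.add_apply]
  rw [integral_const_mul, integral_add hi1 hi2, integral_const_mul, integral_const_mul]
  have h2 := hXs.2
  calc _ ≤ 2 * K ^ 2 * (3 * C * m ^ 2 + Δ ^ 2 * (C * 2)) := by gcongr
    _ = 6 * C * K ^ 2 * m ^ 2 + 4 * C * K ^ 2 * Δ ^ 2 := by ring
    _ ≤ 6 * C * K ^ 2 * m ^ 2 + 6 * C * K ^ 2 * Δ ^ 2 + 12 * C * K ^ 2 * (m * Δ) := by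
        have : 0 ≤ C * K ^ 2 * Δ ^ 2 := by positivity
        have : 0 ≤ C * K ^ 2 * (m * Δ) := by positivity
        linarith
    _ = _ := by ring

theorem truncation_bias [IsProbabilityMeasure μ] (hX : Measurable X) (hy : Measurable y)
    (hl : 1 < l) (hM : 0 < M) (hK : 0 < K) (hζ : 0 < ζ) (hXs : IsSubgaussian μ K X)
    (hyM : Integrable (fun ω => |y ω| ^ (2 * l)) μ ∧ ∫ ω, |y ω| ^ (2 * l) ∂μ ≤ M) :
    Integrable (fun ω => truncate ζ (y ω) * X ω) μ ∧
    |∫ ω, truncate ζ (y ω) * X ω ∂μ - ∫ ω, y ω * X ω ∂μ|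
      ≤ 3 * momentConst l * K * (M ^ (1 / (2 * l))) ^ 2 / ζ := by
  have hX2 := hXs.memLp_two hX hK
  have hy2 : MemLp y 2 μ := (memLp_two_iff_integrable_sq hy.aestronglyMeasurable).2
    (integrable_sq_of_moment hy hl hM hyM).1
  have htm : Measurable fun ω => truncate ζ (y ω) := (measurable_truncate ζ).comp hy
  have ht2 : MemLp (fun ω => truncate ζ (y ω)) 2 μ := by
    refine hy2.mono htm.aestronglyMeasurable (ae_of_all _ fun ω => ?_)
    rw [Real.norm_eq_abs, Real.norm_eq_abs, abs_truncate hζ.le]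
    exact min_le_left _ _
  have hi1 : Integrable (fun ω => truncate ζ (y ω) * X ω) μ := ht2.integrable_mul hX2
  have hi2 : Integrable (fun ω => y ω * X ω) μ := hy2.integrable_mul hX2
  have hp1 : 1 ≤ l / (l - 1) := by rw [le_div_iff₀ (by linarith)]; linarith
  obtain ⟨hi3, hb⟩ := integrable_sq_mul_of_moment hX hy hl hM hXs hyM (g := fun w => w)
    measurable_id (fun w hw => hw) (fun w hw => rpow_le_exp_mul_exp hw (zero_le_one.trans hp1))
  refine ⟨hi1, ?_⟩
  rw [← integral_sub hi1 hi2]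
  refine abs_integral_le_integral_abs.trans ?_
  calc ∫ ω, |truncate ζ (y ω) * X ω - y ω * X ω| ∂μ
      ≤ ∫ ω, K / ζ * (y ω ^ 2 * |X ω / K|) ∂μ := by
        refine integral_mono (hi1.sub hi2).abs (hi3.const_mul _) fun ω => ?_
        simp only
        rw [← sub_mul, abs_mul, abs_sub_comm]
        calc |y ω - truncate ζ (y ω)| * |X ω| ≤ y ω ^ 2 / ζ * |X ω| := by
              gcongr
              exact abs_sub_truncate_le hζ _
          _ = _ := by
              rw [abs_div, abs_of_pos hK]
              field_simp
    _ ≤ K / ζ * (3 * momentConst l * (M ^ (1 / (2 * l))) ^ 2) := by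
        rw [integral_const_mul]
        gcongr
    _ = _ := by ring

theorem ae_abs_quantizedResponse_le {τ : Ω → ℝ} (hτ : Measurable τ) (hΔ : 0 ≤ Δ)
    (hlaw : μ.map τ = ditherLaw Δ) (hζ : 0 ≤ ζ) :
    (∀ᵐ ω ∂μ, |quantizedResponse Δ ζ (y ω) (τ ω)| ≤ |y ω| + Δ) ∧
      ∀ᵐ ω ∂μ, |quantizedResponse Δ ζ (y ω) (τ ω)| ≤ ζ + Δ := by
  have hτae : ∀ᵐ ω ∂μ, |τ ω| ≤ Δ / 2 := by
    have := ae_abs_le_ditherLaw hΔ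
    rw [← hlaw] at this
    exact ae_of_ae_map hτ.aemeasurable this
  have key : ∀ᵐ ω ∂μ, |quantizedResponse Δ ζ (y ω) (τ ω)| ≤ |truncate ζ (y ω)| + Δ := by
    filter_upwards [hτae] with ω hω
    have h1 := abs_quantizer_sub_le hΔ (truncate ζ (y ω) + τ ω)
    have h2 : quantizedResponse Δ ζ (y ω) (τ ω) =
        (quantizer Δ (truncate ζ (y ω) + τ ω) - (truncate ζ (y ω) + τ ω))
          + truncate ζ (y ω) + τ ω := by
      rw [quantizedResponse]; ring
    rw [h2]
    refine (abs_add_three _ _ _).trans ?_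
    linarith
  constructor
  · filter_upwards [key] with ω hω
    have := abs_truncate hζ (y ω)
    linarith [min_le_left |y ω| ζ]
  · filter_upwards [key] with ω hω
    have := abs_truncate hζ (y ω)
    linarith [min_le_right |y ω| ζ]

theorem measurable_quantizedResponse {τ : Ω → ℝ} (hy : Measurable y) (hτ : Measurable τ) :
    Measurable fun ω => quantizedResponse Δ ζ (y ω) (τ ω) :=
  (measurable_quantizer Δ).comp (((measurable_truncate ζ).comp hy).add hτ)

variable [IsProbabilityMeasure μ]

/-- Conditionally on covariate and response, the quantization error has mean zero over the dither,
so it is uncorrelated with the covariate. -/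
theorem integral_quantizedResponse_mul {τ : Ω → ℝ} (hX : Measurable X) (hy : Measurable y)
    (hτ : Measurable τ) (hl : 1 < l) (hM : 0 < M) (hK : 0 < K) (hζ : 0 < ζ) (hΔ : 0 ≤ Δ)
    (hXs : IsSubgaussian μ K X)
    (hyM : Integrable (fun ω => |y ω| ^ (2 * l)) μ ∧ ∫ ω, |y ω| ^ (2 * l) ∂μ ≤ M)
    (hlaw : μ.map τ = ditherLaw Δ) (hind : IndepFun (fun ω => (X ω, y ω)) τ μ) :
    ∫ ω, quantizedResponse Δ ζ (y ω) (τ ω) * X ω ∂μ = ∫ ω, truncate ζ (y ω) * X ω ∂μ := by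
  have hzm := measurable_quantizedResponse (Δ := Δ) (ζ := ζ) hy hτ
  obtain ⟨hz1, hz2⟩ := ae_abs_quantizedResponse_le (y := y) hτ hΔ hlaw hζ.le
  -- The value `lam = 0` extracts plain square integrability.
  have h1 := (bounded_response_moment hX hy hzm hl hM hK hζ hΔ hXs hyM hz1 hz2
    (lam := 0) (by positivity)).1
  have hi1 : Integrable (fun ω => quantizedResponse Δ ζ (y ω) (τ ω) * X ω) μ :=
    (memLp_two_of_integrable_sq_mul_exp (hzm.mul hX) le_rfl h1).integrable one_le_two
  have hi2 := (truncation_bias hX hy hl hM hK hζ hXs hyM).1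
  rw [← sub_eq_zero, ← integral_sub hi1 hi2]
  simp only [← sub_mul]
  have hdp := isProbabilityMeasure_ditherLaw hΔ
  refine integral_mul_eq_zero_of_indepFun (Z := fun ω => (X ω, y ω))
    (f := fun p t => quantizedResponse Δ ζ p.2 t - truncate ζ p.2) (g := fun p => p.1)
    (hX.prodMk hy) hτ hind ?_ measurable_fst ?_ ?_
  · exact (measurable_quantizedResponse (measurable_snd.comp measurable_fst) measurable_snd).sub
      ((measurable_truncate ζ).comp (measurable_snd.comp measurable_fst))
  · intro p
    rw [hlaw, integral_sub _ (integrable_const _)]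
    · simp only [quantizedResponse, integral_quantizer_ditherLaw hΔ]
      simp
    · refine Integrable.of_bound (C := |truncate ζ p.2| + Δ)
        (measurable_quantizedResponse measurable_const measurable_id).aestronglyMeasurable ?_
      filter_upwards [ae_abs_le_ditherLaw hΔ] with t ht
      have h1 := abs_quantizer_sub_le hΔ (truncate ζ p.2 + t)
      have h2 : quantizedResponse Δ ζ p.2 t =
          (quantizer Δ (truncate ζ p.2 + t) - (truncate ζ p.2 + t)) + truncate ζ p.2 + t := by
        rw [quantizedResponse]; ring
      rw [Real.norm_eq_abs, h2]
      refine (abs_add_three _ _ _).trans ?_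
      linarith
  · simp only [sub_mul]
    exact hi1.sub hi2

/-- Concentration of averages of the quantized response times a subgaussian variable. -/
theorem measure_sum_response_ge_le {n : ℕ} {X y z : Fin n → Ω → ℝ} (hX : ∀ k, Measurable (X k))
    (hy : ∀ k, Measurable (y k)) (hz : ∀ k, Measurable (z k))
    (hind : iIndepFun (fun k ω => z k ω * X k ω) μ)
    (hl : 1 < l) (hM : 0 < M) (hK : 0 < K) (hζ : 0 < ζ) (hΔ : 0 ≤ Δ)
    (hXs : ∀ k, IsSubgaussian μ K (X k))
    (hyM : ∀ k, Integrable (fun ω => |y k ω| ^ (2 * l)) μ ∧ ∫ ω, |y k ω| ^ (2 * l) ∂μ ≤ M)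
    (hzy : ∀ k, ∀ᵐ ω ∂μ, |z k ω| ≤ |y k ω| + Δ) (hzζ : ∀ k, ∀ᵐ ω ∂μ, |z k ω| ≤ ζ + Δ)
    {r c B : ℝ} (hr : 0 < r) (hr1 : r ≤ 1) (hB1 : 1 ≤ B) (hcB : c ≤ B)
    (hζr : ζ * r ≤ c * M ^ (1 / (2 * l))) :
    μ.real {ω | n * ((B + 6 * momentConst l) * K * (M ^ (1 / (2 * l)) + Δ) * r)
        ≤ |∑ k, (z k ω * X k ω - ∫ ω', z k ω' * X k ω' ∂μ)|}
      ≤ 2 * Real.exp (-(n * r ^ 2)) := by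
  set m := M ^ (1 / (2 * l)) with hm
  set C := momentConst l
  have hC1 : 1 ≤ C := one_le_momentConst l
  have hm0 : 0 < m := Real.rpow_pos_of_pos hM _
  have hB0 : 0 < B := by linarith
  have hmΔ : 0 < m + Δ := by linarith
  -- Since `ζ * r ≤ c * m`, `r ≤ 1` and `c, 1 ≤ B`, this exponent is at most `1 / (K * (ζ + Δ))`.
  -- The threshold `B + 6 * momentConst l` is chosen so that the variance term is absorbed and `-n *
  -- r ^ 2` remains.
  set lam := r / (K * (m + Δ) * B) with hlam
  have hlam0 : 0 ≤ lam := by positivity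
  have hlam1 : lam ≤ 1 / (K * (ζ + Δ)) := by
    rw [hlam, div_le_div_iff₀ (by positivity) (by positivity)]
    have h1 : r * Δ ≤ B * Δ := by gcongr; linarith
    have h2 : c * m ≤ B * m := by gcongr
    have h3 : r * (ζ + Δ) ≤ (m + Δ) * B := by linarith
    have := mul_le_mul_of_nonneg_left h3 hK.le
    linarith
  have hmom := fun k => bounded_response_moment (hX k) (hy k) (hz k) hl hM hK hζ hΔ (hXs k) (hyM k)
    (hzy k) (hzζ k) hlam1
  refine (measure_sum_sub_integral_ge_le hind (fun k => (hz k).mul (hX k)) hlam0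
    (fun k => (hmom k).1) (fun k => (hmom k).2) _).trans ?_
  gcongr
  have e1 : lam ^ 2 * (6 * C * K ^ 2 * (m + Δ) ^ 2) = 6 * C / B ^ 2 * r ^ 2 := by
    rw [hlam]; field_simp
  have e2 : lam * (n * ((B + 6 * C) * K * (m + Δ) * r)) = n * ((1 + 6 * C / B) * r ^ 2) := by
    rw [hlam]; field_simp
  rw [e1, e2]
  have h4 : 6 * C / B ^ 2 ≤ 6 * C / B := by
    gcongr
    nlinarith
  have h5 : n * (6 * C / B ^ 2 * r ^ 2) ≤ n * (6 * C / B * r ^ 2) := by gcongr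
  linarith

end Response

/-! ### Population identities of the linear model -/

section LinearModel

variable {Ω : Type*} [MeasurableSpace Ω] {μ : Measure Ω} {d : ℕ}
  {x : Ω → Fin d → ℝ} {ε y : Ω → ℝ} {θ : Fin d → ℝ}

theorem memLp_dotProduct_left (hmem : ∀ i, MemLp (fun ω => x ω i) 2 μ) (v : Fin d → ℝ) :
    MemLp (fun ω => v ⬝ᵥ x ω) 2 μ := by
  simp only [dotProduct]
  exact memLp_finsetSum _ fun i _ => (hmem i).const_mul (v i)

variable [IsProbabilityMeasure μ]

theorem integral_dotProduct_eq_zero (hmem : ∀ i, MemLp (fun ω => x ω i) 2 μ)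
    (hmean : ∀ i, ∫ ω, x ω i ∂μ = 0) (v : Fin d → ℝ) : ∫ ω, v ⬝ᵥ x ω ∂μ = 0 := by
  simp only [dotProduct]
  rw [integral_finsetSum _ fun i _ => ((hmem i).integrable one_le_two).const_mul _]
  simp [integral_const_mul, hmean]

/-- The noise need not be centred: its product with a covariate direction has mean zero because the
covariate is centred and independent of it. -/
theorem integral_response_mul (hx : Measurable x) (hε : Measurable ε)
    (hmem : ∀ i, MemLp (fun ω => x ω i) 2 μ) (hmean : ∀ i, ∫ ω, x ω i ∂μ = 0)
    (hy : ∀ ω, y ω = x ω ⬝ᵥ θ + ε ω) (hy2 : MemLp y 2 μ) (hind : IndepFun x ε μ)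
    (v : Fin d → ℝ) :
    ∫ ω, y ω * (v ⬝ᵥ x ω) ∂μ = ∫ ω, (v ⬝ᵥ x ω) * (θ ⬝ᵥ x ω) ∂μ := by
  have hv := memLp_dotProduct_left hmem v
  have hθ := memLp_dotProduct_left hmem θ
  have hε2 : MemLp ε 2 μ := by
    have : ε = y - fun ω => θ ⬝ᵥ x ω := by
      ext ω
      simp [hy ω, dotProduct_comm θ]
    rw [this]
    exact hy2.sub hθ
  have h0 : ∫ ω, (v ⬝ᵥ x ω) * ε ω ∂μ = 0 := by
    have hc : IndepFun (fun ω => v ⬝ᵥ x ω) ε μ :=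
      hind.comp (measurable_dotProduct_left v measurable_id) measurable_id
    rw [hc.integral_fun_mul_eq_mul_integral
      (measurable_dotProduct_left v hx).aestronglyMeasurable hε.aestronglyMeasurable,
      integral_dotProduct_eq_zero hmem hmean, zero_mul]
  have h1 : ∀ ω, y ω * (v ⬝ᵥ x ω) = (v ⬝ᵥ x ω) * (θ ⬝ᵥ x ω) + (v ⬝ᵥ x ω) * ε ω := by
    intro ω
    rw [hy, dotProduct_comm (x ω) θ]
    ring
  simp only [h1]
  have h2 : Integrable (fun ω => (v ⬝ᵥ x ω) * (θ ⬝ᵥ x ω)) μ := hv.integrable_mul hθ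
  have h3 : Integrable (fun ω => (v ⬝ᵥ x ω) * ε ω) μ := hv.integrable_mul hε2
  rw [integral_add h2 h3, h0, add_zero]

/-- Expanding `0 ≤ E (y - θᵀx)²` with `E y θᵀx = E (θᵀx)²` gives `E (θᵀx)² ≤ E y²`. The response
moment thereby bounds the size of the unknown signal. -/
theorem signal_norm_sq_le (hx : Measurable x) (hε : Measurable ε)
    (hmem : ∀ i, MemLp (fun ω => x ω i) 2 μ) (hmean : ∀ i, ∫ ω, x ω i ∂μ = 0)
    (hy : ∀ ω, y ω = x ω ⬝ᵥ θ + ε ω) (hy2 : MemLp y 2 μ) (hind : IndepFun x ε μ) {κ : ℝ}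
    (hlow : κ * l2Norm θ ^ 2 ≤ θ ⬝ᵥ (secondMoment μ x *ᵥ θ)) :
    κ * l2Norm θ ^ 2 ≤ ∫ ω, y ω ^ 2 ∂μ := by
  have hθ := memLp_dotProduct_left hmem θ
  have h1 := integral_response_mul hx hε hmem hmean hy hy2 hind θ
  have h2 : Integrable (fun ω => y ω * (θ ⬝ᵥ x ω)) μ := hy2.integrable_mul hθ
  have h3 : Integrable (fun ω => (θ ⬝ᵥ x ω) * (θ ⬝ᵥ x ω)) μ := hθ.integrable_mul hθ
  have h4 := hy2.integrable_sq
  rw [dotProduct_secondMoment_mulVec hmem] at hlow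
  have h5 : ∫ ω, (2 * (y ω * (θ ⬝ᵥ x ω)) - (θ ⬝ᵥ x ω) * (θ ⬝ᵥ x ω)) ∂μ ≤ ∫ ω, y ω ^ 2 ∂μ :=
    integral_mono ((h2.const_mul 2).sub h3) h4 fun ω => by
      simp only
      nlinarith [sq_nonneg (y ω - θ ⬝ᵥ x ω)]
  rw [integral_sub (h2.const_mul 2) h3, integral_const_mul, h1] at h5
  linarith

end LinearModel

/-! ### Decomposition of the gradient at the true signal -/

section Gradient

variable {n d : ℕ}

/-- Splits the gradient of the quadratic loss at `θ` into two fluctuations and a bias. -/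
theorem abs_sampleCross_sub_le (hn : 0 < n) (x : Fin n → Fin d → ℝ) (z : Fin n → ℝ)
    {θ w : Fin d → ℝ} {ρ : ℝ} (hρ : 0 ≤ ρ) (hθ : θ = ρ • w) (i : Fin d) (e f : Fin n → ℝ)
    {a b c : ℝ} (ha : |∑ k, (z k * (Pi.single i 1 ⬝ᵥ x k) - e k)| ≤ n * a)
    (hb : |∑ k, ((Pi.single i 1 ⬝ᵥ x k) * (w ⬝ᵥ x k) - f k)| ≤ n * b)
    (hc : ∀ k, |e k - ρ * f k| ≤ c) :
    |(sampleCross z x - sampleCov x *ᵥ θ) i| ≤ a + ρ * b + c := by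
  have hn0 : (0 : ℝ) < n := by exact_mod_cast hn
  have h1 : (sampleCov x *ᵥ θ) i
      = (1 / (n : ℝ)) * ∑ k, (Pi.single i 1 ⬝ᵥ x k) * (ρ * (w ⬝ᵥ x k)) := by
    rw [← single_one_dotProduct i (sampleCov x *ᵥ θ), dotProduct_sampleCov_mulVec, hθ]
    simp only [smul_dotProduct, smul_eq_mul]
  have h2 : sampleCross z x i = (1 / (n : ℝ)) * ∑ k, z k * (Pi.single i 1 ⬝ᵥ x k) := by
    simp [sampleCross, Finset.sum_apply]
  have h3 : (sampleCross z x - sampleCov x *ᵥ θ) i = (1 / (n : ℝ)) *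
      (∑ k, (z k * (Pi.single i 1 ⬝ᵥ x k) - e k)
        - ρ * ∑ k, ((Pi.single i 1 ⬝ᵥ x k) * (w ⬝ᵥ x k) - f k) + ∑ k, (e k - ρ * f k)) := by
    rw [Pi.sub_apply, h1, h2, ← mul_sub, Finset.mul_sum, ← Finset.sum_sub_distrib,
      ← Finset.sum_sub_distrib, ← Finset.sum_add_distrib]
    congr 1
    exact Finset.sum_congr rfl fun k _ => by ring
  rw [h3, abs_mul, abs_of_pos (by positivity), one_div, inv_mul_le_iff₀ hn0]
  have h4 : |∑ k, (e k - ρ * f k)| ≤ n * c := by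
    refine (Finset.abs_sum_le_sum_abs _ _).trans ((Finset.sum_le_sum fun k _ => hc k).trans_eq ?_)
    rw [Finset.sum_const, Finset.card_univ, Fintype.card_fin, nsmul_eq_mul]
  have h5 := mul_le_mul_of_nonneg_left hb hρ
  have h6 := abs_add_le (∑ k, (z k * (Pi.single i 1 ⬝ᵥ x k) - e k)
        - ρ * ∑ k, ((Pi.single i 1 ⬝ᵥ x k) * (w ⬝ᵥ x k) - f k)) (∑ k, (e k - ρ * f k))
  have h7 := abs_sub (∑ k, (z k * (Pi.single i 1 ⬝ᵥ x k) - e k))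
    (ρ * ∑ k, ((Pi.single i 1 ⬝ᵥ x k) * (w ⬝ᵥ x k) - f k))
  rw [abs_mul ρ, abs_of_nonneg hρ] at h7
  linarith

end Gradient

/-! ### Absorbing the net cardinality into the sample size -/

section SampleSize

/-- For `d ≥ 2` one has `5 ≤ d³` and `2 ≤ d`, so the prefactor is at most `d ^ (8s + 1)`. Reaching
`d ^ (1 - δ)` then needs an exponent of `8s + δ` in units of `log d`, and this is at most `9 δ s`.
-/
theorem net_union_bound {d s n : ℕ} (hd : 2 ≤ d) (hs : 1 ≤ s) {δ c : ℝ} (hδ : 1 ≤ δ)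
    (hn : 9 * (δ * s * Real.log d) ≤ n * c) :
    (d * 5 : ℝ) ^ (2 * s) * (2 * Real.exp (-(n * c))) ≤ (d : ℝ) ^ (1 - δ) := by
  have hd2 : (2 : ℝ) ≤ d := by exact_mod_cast hd
  have hs1 : (1 : ℝ) ≤ s := by exact_mod_cast hs
  have hd0 : (0 : ℝ) < d := by linarith
  set L := Real.log d with hL
  have hexpL : Real.exp L = d := Real.exp_log hd0
  have hL0 : 0 ≤ L := Real.log_nonneg (by linarith)
  have h5 : (d * 5 : ℝ) ≤ Real.exp (4 * L) := by
    have : Real.exp (4 * L) = (d : ℝ) ^ 4 := by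
      rw [show (4 : ℝ) * L = ((4 : ℕ) : ℝ) * L by norm_num, Real.exp_nat_mul, hexpL]
    rw [this]
    have h8 : (2 : ℝ) ^ 3 ≤ (d : ℝ) ^ 3 := by gcongr
    nlinarith
  calc (d * 5 : ℝ) ^ (2 * s) * (2 * Real.exp (-(n * c)))
      ≤ Real.exp (4 * L) ^ (2 * s) * (Real.exp L * Real.exp (-(n * c))) := by
        gcongr
        rw [hexpL]
        exact hd2
    _ = Real.exp (8 * s * L + L - n * c) := by
        rw [← Real.exp_nat_mul, ← Real.exp_add, ← Real.exp_add]
        push_cast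
        ring_nf
    _ ≤ Real.exp (L * (1 - δ)) := by
        refine Real.exp_le_exp.2 ?_
        have h1 : s * L ≤ δ * (s * L) := le_mul_of_one_le_left (by positivity) hδ
        have h2 : δ * L * 1 ≤ δ * L * s := by gcongr
        linarith
    _ = _ := by rw [Real.rpow_def_of_pos hd0]

end SampleSize

/-! ### Constants and assembly of the high-probability event -/

/-- The sample size constant. -/
noncomputable def sampleConst (κ σ : ℝ) : ℝ := 4 * 10 ^ 8 * σ ^ 4 / κ ^ 2 + 1

theorem one_le_sampleConst (κ σ : ℝ) : 1 ≤ sampleConst κ σ := by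
  have : 0 ≤ 4 * 10 ^ 8 * σ ^ 4 / κ ^ 2 := by positivity
  rw [sampleConst]
  linarith

/-- The constant in front of the high-probability bound of the gradient. -/
noncomputable def gradientConst (l c₁ c₂ : ℝ) : ℝ :=
  4 * (max c₂ 1 + 6 * momentConst l) + 32 + 12 * momentConst l / c₁

theorem gradientConst_pos (l : ℝ) {c₁ : ℝ} (hc₁ : 0 < c₁) (c₂ : ℝ) :
    0 < gradientConst l c₁ c₂ := by
  have := one_le_momentConst l
  have : 1 ≤ max c₂ 1 := le_max_right _ _
  rw [gradientConst]
  positivity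

/-- The event on which the quantized responses deviate from their means along coordinate `i`. -/
def responseDeviationEvent {Ω : Type*} [MeasurableSpace Ω] (μ : Measure Ω) {n d : ℕ}
    (x : Fin n → Ω → Fin d → ℝ) (z : Fin n → Ω → ℝ) (t : ℝ) (i : Fin d) : Set Ω :=
  {ω | n * t ≤ |∑ k, (z k ω * (Pi.single i 1 ⬝ᵥ x k ω)
    - ∫ ω', z k ω' * (Pi.single i 1 ⬝ᵥ x k ω') ∂μ)|}

theorem measurableSet_responseDeviationEvent {Ω : Type*} [MeasurableSpace Ω] (μ : Measure Ω)
    {n d : ℕ} {x : Fin n → Ω → Fin d → ℝ} {z : Fin n → Ω → ℝ} (hx : ∀ k, Measurable (x k))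
    (hz : ∀ k, Measurable (z k)) (t : ℝ) (i : Fin d) :
    MeasurableSet (responseDeviationEvent μ x z t i) := by
  have := fun k => measurable_dotProduct_left (Pi.single i 1) (hx k)
  exact measurableSet_le measurable_const (by fun_prop)

theorem lasso_scaling {κ σ C₁ q r s : ℝ} (hκ : 0 < κ) (a : ℝ) :
    a * (C₁ * (σ ^ 2 / Real.sqrt κ) * q * r) / κ * s
      = a * C₁ * (σ ^ 2 * q / κ ^ (3 / 2 : ℝ)) * (s * r) := by
  have h : κ ^ (3 / 2 : ℝ) = κ * Real.sqrt κ := by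
    rw [Real.sqrt_eq_rpow, ← Real.rpow_one_add' hκ.le (by norm_num)]
    norm_num
  have := Real.sqrt_pos.2 hκ
  rw [h]
  field_simp

/-- The high-probability gradient bound, with `K = 2 * σ` and `r = √(δ log d / n)`. -/
theorem gradient_scaling {κ σ m Δ r ζ ρ l c₁ c₂ : ℝ} (hκ : 0 < κ) (hσ : 0 < σ) (hm : 0 < m)
    (hΔ : 0 ≤ Δ) (hr : 0 < r) (hc₁ : 0 < c₁) (hκσ : κ ≤ (2 * σ) ^ 2)
    (hρ : κ * ρ ^ 2 ≤ m ^ 2) (hζ : c₁ * m ≤ ζ * r) :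
    (max c₂ 1 + 6 * momentConst l) * (2 * σ) * (m + Δ) * r + ρ * (8 * (2 * σ) ^ 2 * r)
      + 3 * momentConst l * (2 * σ) * m ^ 2 / ζ
      ≤ gradientConst l c₁ c₂ * (σ ^ 2 / Real.sqrt κ) * (Δ + m) * r := by
  set C := momentConst l
  have hC : 1 ≤ C := one_le_momentConst l
  have hB : 1 ≤ max c₂ 1 := le_max_right _ _
  have hsκ := Real.sqrt_pos.2 hκ
  have hζ0 : 0 < ζ := by
    by_contra hcon
    have : ζ * r ≤ 0 := mul_nonpos_of_nonpos_of_nonneg (not_lt.1 hcon) hr.le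
    have : 0 < c₁ * m := by positivity
    linarith
  -- All three terms are brought to the common unit `σ² / √κ`; since `√κ ≤ 2σ`, a bare factor `2σ`
  -- is at most four such units.
  have hK : 2 * σ ≤ 4 * (σ ^ 2 / Real.sqrt κ) := by
    have h1 : Real.sqrt κ ≤ 2 * σ := Real.sqrt_le_iff.2 ⟨by positivity, hκσ⟩
    rw [← mul_div_assoc, le_div_iff₀ hsκ]
    nlinarith
  have hρ' : ρ ≤ m / Real.sqrt κ := by
    rw [le_div_iff₀ hsκ]
    refine le_of_sq_le_sq ?_ hm.le
    rw [mul_pow, Real.sq_sqrt hκ.le]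
    linarith
  have hζ' : m ^ 2 / ζ ≤ m * r / c₁ := by
    rw [div_le_div_iff₀ hζ0 hc₁]
    nlinarith
  have t1 : (max c₂ 1 + 6 * C) * (2 * σ) * (m + Δ) * r
      ≤ (max c₂ 1 + 6 * C) * (4 * (σ ^ 2 / Real.sqrt κ)) * (m + Δ) * r := by gcongr
  have t2 : ρ * (8 * (2 * σ) ^ 2 * r) ≤ 32 * (σ ^ 2 / Real.sqrt κ) * (m + Δ) * r := by
    calc ρ * (8 * (2 * σ) ^ 2 * r) ≤ m / Real.sqrt κ * (8 * (2 * σ) ^ 2 * r) := by gcongr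
      _ = 32 * (σ ^ 2 / Real.sqrt κ) * m * r := by ring
      _ ≤ _ := by gcongr; linarith
  have t3 : 3 * C * (2 * σ) * m ^ 2 / ζ
      ≤ 12 * C / c₁ * (σ ^ 2 / Real.sqrt κ) * (m + Δ) * r := by
    calc 3 * C * (2 * σ) * m ^ 2 / ζ = 3 * C * (2 * σ) * (m ^ 2 / ζ) := by ring
      _ ≤ 3 * C * (4 * (σ ^ 2 / Real.sqrt κ)) * (m * r / c₁) := by gcongr
      _ = 12 * C / c₁ * (σ ^ 2 / Real.sqrt κ) * m * r := by ring
      _ ≤ _ := by gcongr; linarith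
  rw [gradientConst]
  linarith

/-- The three families contribute `1 + 2 + 2 = 5` multiples of `d ^ (1 - δ)`, so the constant 9
leaves slack. -/
theorem measure_union_deviation_le {Ω : Type*} [MeasurableSpace Ω] {μ : Measure Ω} {d : ℕ}
    (hd : 2 ≤ d) {δ : ℝ} {E : Set Ω} {F G : Fin d → Set Ω} (hE : μ.real E ≤ (d : ℝ) ^ (1 - δ))
    (hF : ∀ i, μ.real (F i) ≤ 2 * Real.exp (-(δ * Real.log d)))
    (hG : ∀ i, μ.real (G i) ≤ 2 * Real.exp (-(δ * Real.log d))) :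
    μ.real (E ∪ ((⋃ i, F i) ∪ ⋃ i, G i)) ≤ 9 * (d : ℝ) ^ (1 - δ) := by
  have hd0 : (0 : ℝ) < d := by exact_mod_cast (by omega : 0 < d)
  have hpow : d * (2 * Real.exp (-(δ * Real.log d))) = 2 * (d : ℝ) ^ (1 - δ) := by
    rw [sub_eq_add_neg, Real.rpow_add hd0, Real.rpow_one, Real.rpow_def_of_pos hd0]
    ring_nf
  have hsum : ∀ H : Fin d → Set Ω, (∀ i, μ.real (H i) ≤ 2 * Real.exp (-(δ * Real.log d))) →
      μ.real (⋃ i, H i) ≤ 2 * (d : ℝ) ^ (1 - δ) := by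
    intro H hH
    refine (measureReal_iUnion_fintype_le _).trans ((Finset.sum_le_sum fun i _ => hH i).trans_eq ?_)
    rw [Finset.sum_const, Finset.card_univ, Fintype.card_fin, nsmul_eq_mul, hpow]
  have h1 := measureReal_union_le (μ := μ) E ((⋃ i, F i) ∪ ⋃ i, G i)
  have h2 := measureReal_union_le (μ := μ) (⋃ i, F i) (⋃ i, G i)
  have h3 := hsum F hF
  have h4 := hsum G hG
  have h5 : (0 : ℝ) ≤ (d : ℝ) ^ (1 - δ) := by positivity
  linarith

set_option maxHeartbeats 1000000 in
/-- The error bound for `2 ≤ d` and `1 ≤ δ`, where the probability estimate is not trivial. -/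
theorem quantizedLasso_error {l c₁ c₂ C₁ : ℝ} (hl : 1 < l) (hc₁ : 0 < c₁)
    (hC₁ : 2 * gradientConst l c₁ c₂ ≤ C₁) {n d s : ℕ} {κ₀ κ₁ σ M Δ δ ζ lam : ℝ}
    {θs : Fin d → ℝ} {Ω : Type*} [MeasurableSpace Ω] {μ : Measure Ω} [IsProbabilityMeasure μ]
    {x : Fin n → Ω → Fin d → ℝ} {ε τ y : Fin n → Ω → ℝ} (hd : 2 ≤ d) (hδ : 1 ≤ δ)
    (hs : 1 ≤ s) (hκ₀ : 0 < κ₀) (hσ : 0 < σ) (hM : 0 < M) (hΔ : 0 ≤ Δ)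
    (hsparse : IsSparse s θs) (hy : ∀ k ω, y k ω = x k ω ⬝ᵥ θs + ε k ω)
    (hx : ∀ k, Measurable (x k)) (hε : ∀ k, Measurable (ε k)) (hτ : ∀ k, Measurable (τ k))
    (hxi : iIndepFun x μ) (hεi : iIndepFun ε μ)
    (hxε : IndepFun (fun ω k => x k ω) (fun ω k => ε k ω) μ)
    (hτi : iIndepFun τ μ) (hlaw : ∀ k, μ.map (τ k) = ditherLaw Δ)
    (hxετ : IndepFun (fun ω => ((fun k => x k ω), (fun k => ε k ω))) (fun ω k => τ k ω) μ)
    (hmean : ∀ k i, ∫ ω, x k ω i ∂μ = 0)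
    (hpsi : ∀ k, psi2NormVec μ (x k) ≤ ENNReal.ofReal σ)
    (hspec : ∀ k, spectrum ℝ (secondMoment μ (x k)) ⊆ Set.Icc κ₀ κ₁)
    (hmom : ∀ k, ∫⁻ ω, ENNReal.ofReal (|y k ω| ^ (2 * l)) ∂μ ≤ ENNReal.ofReal M)
    (hζ1 : c₁ * Real.sqrt (n * M ^ (1 / l) / (δ * Real.log d)) ≤ ζ)
    (hζ2 : ζ ≤ c₂ * Real.sqrt (n * M ^ (1 / l) / (δ * Real.log d)))
    (hlam : lam = C₁ * (σ ^ 2 / Real.sqrt κ₀) * (Δ + M ^ (1 / (2 * l)))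
        * Real.sqrt (δ * Real.log d / n))
    (hN : sampleConst κ₀ σ * (δ * s * Real.log d) ≤ n) :
    ∃ A : Set Ω, MeasurableSet A ∧ 1 - 9 * (d : ℝ) ^ (1 - δ) ≤ μ.real A ∧
      ∀ ω ∈ A,
        (generalizedLasso Set.univ (sampleCov fun k => x k ω)
          (sampleCross (fun k => quantizedResponse Δ ζ (y k ω) (τ k ω)) fun k => x k ω)
          lam).Nonempty ∧
        ∀ θh ∈ generalizedLasso Set.univ (sampleCov fun k => x k ω)
          (sampleCross (fun k => quantizedResponse Δ ζ (y k ω) (τ k ω)) fun k => x k ω) lam,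
          l2Norm (θh - θs) ≤ 6 * C₁ * (σ ^ 2 * (Δ + M ^ (1 / (2 * l))) / κ₀ ^ (3 / 2 : ℝ))
            * Real.sqrt (δ * s * Real.log d / n) ∧
          l1Norm (θh - θs) ≤ 24 * C₁ * (σ ^ 2 * (Δ + M ^ (1 / (2 * l))) / κ₀ ^ (3 / 2 : ℝ))
            * s * Real.sqrt (δ * Real.log d / n) := by
  have hd2 : (2 : ℝ) ≤ d := by exact_mod_cast hd
  have hs1 : (1 : ℝ) ≤ s := by exact_mod_cast hs
  have hl0 : 0 < l := by linarith
  have hL : 0 < Real.log d := Real.log_pos (by linarith)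
  set U := δ * Real.log d with hU
  have hU0 : 0 < U := by positivity
  have hUs : δ * s * Real.log d = s * U := by rw [hU]; ring
  rw [hUs] at hN ⊢
  have hUsU : U ≤ s * U := le_mul_of_one_le_left hU0.le hs1
  have hsC := one_le_sampleConst κ₀ σ
  have hUn : U ≤ n := by
    have : s * U ≤ sampleConst κ₀ σ * (s * U) := le_mul_of_one_le_left (by positivity) hsC
    linarith
  have hn0 : (0 : ℝ) < n := hU0.trans_le hUn
  have hn : 0 < n := by exact_mod_cast hn0
  set m := M ^ (1 / (2 * l)) with hm
  have hm0 : 0 < m := Real.rpow_pos_of_pos hM _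
  have hmsq : M ^ (1 / l) = m ^ 2 := by
    rw [hm, ← Real.rpow_natCast, ← Real.rpow_mul hM.le]
    congr 1
    push_cast
    field_simp
  set r := Real.sqrt (U / n) with hr
  have hr0 : 0 < r := Real.sqrt_pos.2 (by positivity)
  have hrsq : r ^ 2 = U / n := Real.sq_sqrt (by positivity)
  have hnr : n * r ^ 2 = U := by rw [hrsq]; field_simp
  have hr1 : r ≤ 1 := Real.sqrt_le_one.2 ((div_le_one hn0).2 hUn)
  -- In these units the prescribed threshold is `m / r` up to the constants `c₁` and `c₂`.
  have hsq : Real.sqrt (n * M ^ (1 / l) / U) = m / r := by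
    rw [hmsq, show n * m ^ 2 / U = (m / r) ^ 2 by rw [div_pow, hrsq]; field_simp,
      Real.sqrt_sq (by positivity)]
  rw [hsq] at hζ1 hζ2
  have hζ0 : 0 < ζ := lt_of_lt_of_le (by positivity) hζ1
  have hζ1' : c₁ * m ≤ ζ * r := by
    rwa [← mul_div_assoc, div_le_iff₀ hr0] at hζ1
  have hζ2' : ζ * r ≤ c₂ * m := by
    rwa [← mul_div_assoc, le_div_iff₀ hr0] at hζ2
  have hK : 0 < 2 * σ := by positivity
  have hsub : ∀ k v, l2Norm v ≤ 1 → IsSubgaussian μ (2 * σ) fun ω => v ⬝ᵥ x k ω :=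
    fun k v hv => isSubgaussian_dotProduct (hx k) hσ (hpsi k) hv
  have hei : ∀ i : Fin d, l2Norm (Pi.single i (1 : ℝ)) ≤ 1 := fun i => (l2Norm_single i).le
  have hmem : ∀ k i, MemLp (fun ω => x k ω i) 2 μ := by
    intro k i
    have := (hsub k _ (hei i)).memLp_two (measurable_dotProduct_left _ (hx k)) hK
    simpa only [single_one_dotProduct] using this
  have hlow : ∀ k v, κ₀ * l2Norm v ^ 2 ≤ v ⬝ᵥ (secondMoment μ (x k) *ᵥ v) := by
    intro k
    refine le_quadratic_of_spectrum_subset ?_ (hspec k)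
    ext i j
    simp [secondMoment, mul_comm]
  have hym : ∀ k, Measurable (y k) := by
    intro k
    have : y k = fun ω => θs ⬝ᵥ x k ω + ε k ω := by
      ext ω
      rw [hy, dotProduct_comm]
    rw [this]
    exact (measurable_dotProduct_left θs (hx k)).add (hε k)
  have hyM : ∀ k, Integrable (fun ω => |y k ω| ^ (2 * l)) μ ∧ ∫ ω, |y k ω| ^ (2 * l) ∂μ ≤ M :=
    fun k => integrable_rpow_of_lintegral_le (hym k) hM (hmom k)
  have hy2 := fun k => integrable_sq_of_moment (hym k) hl hM (hyM k)
  have hy2' : ∀ k, MemLp (y k) 2 μ := fun k =>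
    (memLp_two_iff_integrable_sq (hym k).aestronglyMeasurable).2 (hy2 k).1
  have hxεk : ∀ k, IndepFun (x k) (ε k) μ := fun k =>
    hxε.comp (measurable_pi_apply k) (measurable_pi_apply k)
  have hρm : κ₀ * l2Norm θs ^ 2 ≤ m ^ 2 :=
    (signal_norm_sq_le (hx ⟨0, hn⟩) (hε _) (hmem _) (hmean _) (hy _) (hy2' _) (hxεk _)
      (hlow _ θs)).trans (hy2 _).2
  -- The second moment of one coordinate is at least `κ₀` by the spectrum and at most `K²` by
  -- sub-Gaussianity.
  have hκσ : κ₀ ≤ (2 * σ) ^ 2 := by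
    have h1 := hlow ⟨0, hn⟩ (Pi.single (⟨0, by omega⟩ : Fin d) 1)
    rw [l2Norm_single, dotProduct_secondMoment_mulVec (hmem _)] at h1
    have h2 := ((hsub ⟨0, hn⟩ _ (hei ⟨0, by omega⟩)).integrable_sq
      (measurable_dotProduct_left _ (hx _)) hK).2
    simp only [sq] at h1 h2 ⊢
    linarith
  set ρ := l2Norm θs with hρ
  have hρ0 : 0 ≤ ρ := l2Norm_nonneg θs
  -- Normalizing the signal lets the sub-Gaussian bound on the unit ball apply, with the factor `ρ`
  -- kept outside. For `θs = 0` the convention `0⁻¹ = 0` gives `w = 0`.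
  set w : Fin d → ℝ := ρ⁻¹ • θs with hw
  have hw1 : l2Norm w ≤ 1 := by
    rw [hw, l2Norm_smul, abs_of_nonneg (inv_nonneg.2 hρ0)]
    exact inv_mul_le_one
  have hθw : θs = ρ • w := by
    rcases hρ0.eq_or_lt with h0 | h0
    · rw [← h0, zero_smul]
      exact l2Norm_eq_zero h0.symm
    · rw [hw, smul_smul, mul_inv_cancel₀ h0.ne', one_smul]
  set z : Fin n → Ω → ℝ := fun k ω => quantizedResponse Δ ζ (y k ω) (τ k ω) with hz
  have hzm : ∀ k, Measurable (z k) := fun k => measurable_quantizedResponse (hym k) (hτ k)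
  have hzb := fun k => ae_abs_quantizedResponse_le (y := y k) (hτ k) hΔ (hlaw k) hζ0.le
  have hmeas_y : Measurable fun p : (Fin d → ℝ) × ℝ => p.1 ⬝ᵥ θs + p.2 := by
    simp only [dotProduct]
    fun_prop
  have htriple : iIndepFun (fun k ω => ((x k ω, ε k ω), τ k ω)) μ := by
    refine iIndepFun_prodMk_of_indepFun (fun k => (hx k).prodMk (hε k)) hτ
      (iIndepFun_prodMk_of_indepFun hx hε hxi hεi hxε) hτi ?_
    refine hxετ.comp (φ := fun p k => (p.1 k, p.2 k)) (ψ := id) ?_ measurable_id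
    exact measurable_pi_lambda _ fun k =>
      ((measurable_pi_apply k).comp measurable_fst).prodMk
        ((measurable_pi_apply k).comp measurable_snd)
  have hzxi : ∀ i : Fin d, iIndepFun (fun k ω => z k ω * (Pi.single i 1 ⬝ᵥ x k ω)) μ := by
    intro i
    have hg : Measurable fun p : ((Fin d → ℝ) × ℝ) × ℝ =>
        quantizedResponse Δ ζ (p.1.1 ⬝ᵥ θs + p.1.2) p.2 * (Pi.single i 1 ⬝ᵥ p.1.1) :=
      (measurable_quantizedResponse (hmeas_y.comp measurable_fst) measurable_snd).mul
        (measurable_dotProduct_left _ (measurable_fst.comp measurable_fst))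
    have := htriple.comp (fun _ => _) fun _ => hg
    simpa only [Function.comp_def, ← hy] using this
  have hyτ : ∀ (i : Fin d) k, IndepFun (fun ω => (Pi.single i 1 ⬝ᵥ x k ω, y k ω)) (τ k) μ := by
    intro i k
    have hφ : Measurable fun p : (Fin n → Fin d → ℝ) × (Fin n → ℝ) =>
        ((Pi.single i 1 ⬝ᵥ p.1 k : ℝ), p.1 k ⬝ᵥ θs + p.2 k) :=
      (measurable_dotProduct_left _ ((measurable_pi_apply k).comp measurable_fst)).prodMk
        (Measurable.comp (f := fun p : (Fin n → Fin d → ℝ) × (Fin n → ℝ) => (p.1 k, p.2 k)) hmeas_y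
          (((measurable_pi_apply k).comp measurable_fst).prodMk
            ((measurable_pi_apply k).comp measurable_snd)))
    have := hxετ.comp hφ (measurable_pi_apply k)
    simpa only [Function.comp_def, ← hy] using this
  have hbias : ∀ (i : Fin d) k, |∫ ω, z k ω * (Pi.single i 1 ⬝ᵥ x k ω) ∂μ
      - ρ * ∫ ω, (Pi.single i 1 ⬝ᵥ x k ω) * (w ⬝ᵥ x k ω) ∂μ|
      ≤ 3 * momentConst l * (2 * σ) * m ^ 2 / ζ := by
    intro i k
    have hXm := measurable_dotProduct_left (Pi.single i (1 : ℝ)) (hx k)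
    have h1 := integral_quantizedResponse_mul hXm (hym k) (hτ k) hl hM hK hζ0 hΔ
      (hsub k _ (hei i)) (hyM k) (hlaw k) (hyτ i k)
    have h2 := integral_response_mul (hx k) (hε k) (hmem k) (hmean k) (hy k) (hy2' k) (hxεk k)
      (Pi.single i 1)
    have h3 : ρ * ∫ ω, (Pi.single i 1 ⬝ᵥ x k ω) * (w ⬝ᵥ x k ω) ∂μ
        = ∫ ω, y k ω * (Pi.single i 1 ⬝ᵥ x k ω) ∂μ := by
      rw [h2, ← integral_const_mul]
      congr 1 with ω
      have h4 : θs ⬝ᵥ x k ω = ρ * (w ⬝ᵥ x k ω) := by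
        conv_lhs => rw [hθw]
        rw [smul_dotProduct, smul_eq_mul]
      rw [h4]
      ring
    rw [h3, h1]
    exact (truncation_bias hXm (hym k) hl hM hK hζ0 (hsub k _ (hei i)) (hyM k)).2
  set t₁ := (max c₂ 1 + 6 * momentConst l) * (2 * σ) * (m + Δ) * r with ht₁
  -- Chosen so that `t₂² / (64 K⁴) = r²`, which turns the tail into `exp (-δ log d)`; `r ≤ 1` gives
  -- the required `t₂ ≤ 16 K²`.
  set t₂ := 8 * (2 * σ) ^ 2 * r with ht₂
  set bad : Set Ω := sparseDeviationEvent μ x (κ₀ / 200) s ∪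
    ((⋃ i : Fin d, deviationEvent μ x t₂ (Pi.single i 1) w) ∪
      ⋃ i : Fin d, responseDeviationEvent μ x z t₁ i) with hbad
  have hbadm : MeasurableSet bad :=
    (measurableSet_sparseDeviationEvent hx _ _).union
      ((MeasurableSet.iUnion fun i => measurableSet_deviationEvent hx _ _ _).union
        (MeasurableSet.iUnion fun i => measurableSet_responseDeviationEvent μ hx hzm _ _))
  have hbadp : μ.real bad ≤ 9 * (d : ℝ) ^ (1 - δ) := by
    refine measure_union_deviation_le hd ?_ (fun i => ?_) fun i => ?_
    · refine (measure_sparseDeviationEvent_le hx hxi hK hsub (t := κ₀ / 200) (by positivity)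
        (by linarith) s).trans ?_
      rw [mul_div_assoc]
      refine net_union_bound hd hs hδ ?_
      rw [hUs]
      -- The numerical constant in `sampleConst` is fixed here: `4 * 10 ^ 8 / (200 ^ 2 * 64 * 2 ^
      -- 4)` slightly exceeds 9.
      calc 9 * (s * U) ≤ (sampleConst κ₀ σ * (s * U)) * ((κ₀ / 200) ^ 2 / (64 * (2 * σ) ^ 4)) := by
            have h1 : 9 ≤ sampleConst κ₀ σ * ((κ₀ / 200) ^ 2 / (64 * (2 * σ) ^ 4)) := by
              calc (9 : ℝ) ≤ 4 * 10 ^ 8 * σ ^ 4 / κ₀ ^ 2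
                    * ((κ₀ / 200) ^ 2 / (64 * (2 * σ) ^ 4)) := by
                    have : 4 * 10 ^ 8 * σ ^ 4 / κ₀ ^ 2 * ((κ₀ / 200) ^ 2 / (64 * (2 * σ) ^ 4))
                        = 4 * 10 ^ 8 / (200 ^ 2 * 64 * 2 ^ 4) := by field_simp
                    rw [this]
                    norm_num
                _ ≤ _ := by
                    rw [sampleConst]
                    gcongr
                    linarith
            calc 9 * (s * U) ≤ sampleConst κ₀ σ * ((κ₀ / 200) ^ 2 / (64 * (2 * σ) ^ 4))
                  * (s * U) := by gcongr
              _ = _ := by ring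
        _ ≤ _ := by gcongr
    · refine (measure_deviationEvent_le hx hxi hK hsub (t := t₂) (by positivity) ?_ (hei i)
        hw1).trans_eq ?_
      · rw [ht₂]
        nlinarith [sq_nonneg (2 * σ)]
      · rw [← hU, ← hnr, ht₂]
        congr 3
        field_simp
        norm_num
    · rw [← hU, ← hnr]
      exact measure_sum_response_ge_le
        (fun k => measurable_dotProduct_left _ (hx k)) hym hzm (hzxi i) hl hM hK hζ0 hΔ
        (fun k => hsub k _ (hei i)) hyM (fun k => (hzb k).1) (fun k => (hzb k).2) hr0 hr1
        (le_max_right _ _) (le_max_left _ _) hζ2'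
  refine ⟨badᶜ, hbadm.compl, ?_, fun ω hω => ?_⟩
  · rw [probReal_compl_eq_one_sub hbadm]
    linarith
  have hω1 : ω ∉ sparseDeviationEvent μ x (κ₀ / 200) s := fun h => hω (Or.inl h)
  have hω2 : ∀ i : Fin d, ω ∉ deviationEvent μ x t₂ (Pi.single i 1) w :=
    fun i h => hω (Or.inr (Or.inl (Set.mem_iUnion.2 ⟨i, h⟩)))
  have hω3 : ∀ i : Fin d, ω ∉ responseDeviationEvent μ x z t₁ i :=
    fun i h => hω (Or.inr (Or.inr (Set.mem_iUnion.2 ⟨i, h⟩)))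
  have hq0 : 0 ≤ σ ^ 2 / Real.sqrt κ₀ * (Δ + m) * r := by positivity
  have hgc := gradientConst_pos l hc₁ c₂
  have hC₁0 : 0 < C₁ := by linarith
  have hlam0 : 0 < lam := by rw [hlam]; positivity
  have hgrad : ∀ i, |(sampleCross (fun k => z k ω) (fun k => x k ω)
      - sampleCov (fun k => x k ω) *ᵥ θs) i| ≤ lam / 2 := by
    intro i
    refine (abs_sampleCross_sub_le hn (fun k => x k ω) (fun k => z k ω) hρ0 hθw i _ _
      (not_le.1 (hω3 i)).le (not_le.1 (hω2 i)).le (hbias i)).trans ?_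
    refine (gradient_scaling (c₂ := c₂) hκ₀ hσ hm0 hΔ hr0 hc₁ hκσ hρm hζ1').trans ?_
    rw [hlam]
    have := mul_le_mul_of_nonneg_right hC₁ hq0
    linarith
  have hsymm := isSymm_sampleCov fun k => x k ω
  have hpos := sampleCov_nonneg fun k => x k ω
  refine ⟨generalizedLasso_nonempty _ hsymm hpos _ θs hlam0 hgrad, fun θh hθh => ?_⟩
  obtain ⟨h1, h2⟩ := generalizedLasso_error _ hsymm hpos _ θs θh hlam0 hκ₀ hsparse hgrad
    (fun h hh => restricted_eigenvalue hn (by omega) hs hmem hκ₀ hlow hω1 hh) hθh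
  constructor
  · refine h1.trans_eq ?_
    rw [hlam, lasso_scaling hκ₀, mul_div_assoc (s : ℝ) U, Real.sqrt_mul (by positivity)]
  · refine h2.trans_eq ?_
    rw [hlam, lasso_scaling hκ₀]
    ring

end QuantizedCS

theorem theorem3p4 :
    -- the constant of the sample size condition, a function of `κ₀` and `σ` only
    ∃ N : ℝ → ℝ → ℝ, (∀ κ₀ σ, 0 < N κ₀ σ) ∧
    -- the moment order and the constants hidden in the choice of the threshold
    ∀ l : ℝ, 1 < l → ∀ c₁ c₂ : ℝ, 0 < c₁ → 0 < c₂ →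
    -- sufficiently large `C₁`
    ∃ C₀ : ℝ, 0 < C₀ ∧ ∀ C₁ : ℝ, C₀ ≤ C₁ →
    ∃ C₃ C₄ : ℝ, 0 < C₃ ∧ 0 < C₄ ∧
    ∀ (n d s : ℕ) (κ₀ κ₁ σ M Δ δ ζ lam : ℝ) (θs : Fin d → ℝ)
      (Ω : Type*) [MeasurableSpace Ω] (μ : Measure Ω) [IsProbabilityMeasure μ]
      (x : Fin n → Ω → Fin d → ℝ) (ε τ : Fin n → Ω → ℝ) (y : Fin n → Ω → ℝ),
      1 ≤ s → 0 < κ₀ → κ₀ < κ₁ → 0 < σ → 0 < M → 0 ≤ Δ → 0 < δ →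
      -- the sparse linear model
      IsSparse s θs →
      (∀ k ω, y k ω = x k ω ⬝ᵥ θs + ε k ω) →
      (∀ k, Measurable (x k)) → (∀ k, Measurable (ε k)) → (∀ k, Measurable (τ k)) →
      -- i.i.d. covariates, i.i.d. noise independent of the covariates
      iIndepFun x μ → (∀ j k, IdentDistrib (x j) (x k) μ μ) →
      iIndepFun ε μ → (∀ j k, IdentDistrib (ε j) (ε k) μ μ) →
      IndepFun (fun ω k => x k ω) (fun ω k => ε k ω) μ →
      -- i.i.d. uniform dither independent of the covariates and the noise
      iIndepFun τ μ → (∀ k, μ.map (τ k) = ditherLaw Δ) →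
      IndepFun (fun ω => ((fun k => x k ω), (fun k => ε k ω))) (fun ω k => τ k ω) μ →
      -- zero-mean sub-Gaussian covariates whose covariance has its eigenvalues in `[κ₀, κ₁]`
      (∀ k i, ∫ ω, x k ω i ∂μ = 0) →
      (∀ k, psi2NormVec μ (x k) ≤ ENNReal.ofReal σ) →
      (∀ k, spectrum ℝ (secondMoment μ (x k)) ⊆ Set.Icc κ₀ κ₁) →
      -- the moment bound `E |y_k|^(2l) ≤ M`
      (∀ k, ∫⁻ ω, ENNReal.ofReal (|y k ω| ^ (2 * l)) ∂μ ≤ ENNReal.ofReal M) →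
      -- the choice of the threshold and of the regularization parameter
      c₁ * Real.sqrt (n * M ^ (1 / l) / (δ * Real.log d)) ≤ ζ →
      ζ ≤ c₂ * Real.sqrt (n * M ^ (1 / l) / (δ * Real.log d)) →
      lam = C₁ * (σ ^ 2 / Real.sqrt κ₀) * (Δ + M ^ (1 / (2 * l)))
        * Real.sqrt (δ * Real.log d / n) →
      -- the sample size
      N κ₀ σ * (δ * s * Real.log d) ≤ n →
      ∃ A : Set Ω, MeasurableSet A ∧ 1 - 9 * (d : ℝ) ^ (1 - δ) ≤ μ.real A ∧
        ∀ ω ∈ A,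
          (generalizedLasso Set.univ (sampleCov fun k => x k ω)
            (sampleCross (fun k => quantizedResponse Δ ζ (y k ω) (τ k ω)) fun k => x k ω)
            lam).Nonempty ∧
          ∀ θh ∈ generalizedLasso Set.univ (sampleCov fun k => x k ω)
            (sampleCross (fun k => quantizedResponse Δ ζ (y k ω) (τ k ω)) fun k => x k ω) lam,
            l2Norm (θh - θs) ≤ C₃ * (σ ^ 2 * (Δ + M ^ (1 / (2 * l))) / κ₀ ^ (3 / 2 : ℝ))
              * Real.sqrt (δ * s * Real.log d / n) ∧
            l1Norm (θh - θs) ≤ C₄ * (σ ^ 2 * (Δ + M ^ (1 / (2 * l))) / κ₀ ^ (3 / 2 : ℝ))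
              * s * Real.sqrt (δ * Real.log d / n) := by 
  refine ⟨sampleConst, fun κ₀ σ => zero_lt_one.trans_le (one_le_sampleConst κ₀ σ), ?_⟩
  intro l hl c₁ c₂ hc₁ hc₂
  have hgc := gradientConst_pos l hc₁ c₂
  refine ⟨2 * gradientConst l c₁ c₂, by positivity, fun C₁ hC₁ => ?_⟩
  have hC₁0 : 0 < C₁ := by linarith
  refine ⟨6 * C₁, 24 * C₁, by positivity, by positivity, ?_⟩
  intro n d s κ₀ κ₁ σ M Δ δ ζ lam θs Ω _ μ _ x ε τ y hs hκ₀ _ hσ hM hΔ hδ hsparse hy hx hε hτ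
    hxi _ hεi _ hxε hτi hlaw hxετ hmean hpsi hspec hmom hζ1 hζ2 hlam hN
  -- Dimension zero is separate because `0 ^ (1 - δ)` can vanish, so the empty event would not
  -- suffice; there all vectors coincide and the full event works.
  rcases Nat.eq_zero_or_pos d with rfl | hd
  · refine ⟨Set.univ, MeasurableSet.univ, ?_, fun ω _ => ⟨⟨0, Set.mem_univ _, fun θ _ => ?_⟩, ?_⟩⟩
    · rw [probReal_univ]
      have : (0 : ℝ) ≤ ((0 : ℕ) : ℝ) ^ (1 - δ) := by positivity
      linarith
    · simp [Subsingleton.elim θ 0]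
    · intro θh _
      constructor
      · have : l2Norm (θh - θs) = 0 := by simp [l2Norm]
        rw [this]
        positivity
      · have : l1Norm (θh - θs) = 0 := by simp [l1Norm]
        rw [this]
        positivity
  -- If `d = 1` or `δ < 1`, then `d ^ (1 - δ) ≥ 1`, the claimed probability is negative, and the
  -- empty event suffices.
  by_cases hcase : 2 ≤ d ∧ 1 ≤ δ
  · exact quantizedLasso_error hl hc₁ hC₁ hcase.1 hcase.2 hs hκ₀ hσ hM hΔ hsparse hy hx hε hτ hxi
      hεi hxε hτi hlaw hxετ hmean hpsi hspec hmom hζ1 hζ2 hlam hN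
  · refine ⟨∅, MeasurableSet.empty, ?_, fun ω hω => absurd hω (Set.notMem_empty ω)⟩
    have h1 : (1 : ℝ) ≤ (d : ℝ) ^ (1 - δ) := by
      rcases not_and_or.1 hcase with h | h
      · obtain rfl : d = 1 := by omega
        simp
      · exact Real.one_le_rpow (by exact_mod_cast hd) (by linarith)
    rw [measureReal_empty]
    linarith
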